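/- **Theorem.** Let $(a_n)$ be an increasing sequence of positive real numbers with $a_n\to\infty$. Then there are a bounded domain $\Omega\subset\subset\mathbb C^3$ with $C^\infty$ boundary, a $C^\infty$ defining function $r:\mathbb C^3\to\mathbb R$ of it ($\Omega=\{r<0\}$ and $\nabla r\neq 0$ on $\{r=0\}$), a boundary point $P\in\partial\Omega$, and a strictly decreasing sequence of positive numbers $\delta_n\to 0$ such that, with $\nu=\nabla r(P)/\|\nabla r(P)\|$ the unit outward normal at $P$: 1. $\Omega$ is (Levi) pseudoconvex, and $P$ is a boundary point of infinite type in the sense of D'Angelo: $\sup_\gamma \operatorname{ord}_0(r\circ\gamma)/\operatorname{ord}_0(\gamma-P)=\infty$, where $\gamma$ runs over the nonconstant germs of holomorphic curves $(\mathbb C,0)\to(\mathbb C^3,P)$; 2. $P=0$, and near $P$, in the coordinates $(s,t,w)$ of $\mathbb C^3$, $r(s,t,w)=\operatorname{Re} w+\tilde\rho(s,t)$, where $\tilde\rho$ is a $C^\infty$ plurisubharmonic function near $0\in\mathbb C^2$ with $\tilde\rho(0)=0$ and $d\tilde\rho(0)=0$; so near $P$ the domain is $\{\operatorname{Re} w+\tilde\rho(s,t)<0\}$;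 3. for all $n$, $P-\delta_n\nu\in\Omega$ and $$F_K(P-\delta_n\nu,\nu)\le\frac{1}{a_n\delta_n},$$ where $F_K(Q,X)=\inf\{\alpha>0:\ \exists\,\varphi:\mathbb D\to\Omega \text{ holomorphic},\ \varphi(0)=Q,\ \varphi'(0)=X/\alpha\}$ is the Kobayashi metric of $\Omega$ and $\mathbb D$ is the unit disc in $\mathbb C$. In particular, there is no constant $C>0$ such that $F_K(P-\delta\nu,\nu)\ge C/\delta$ for all sufficiently small $\delta>0$. -/

import Mathlib

open Set Filter Topology Metric Asymptotics Gradient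
open scoped ContDiff ENNReal

noncomputable section

/-- Complex Euclidean space `ℂⁿ`, with its Euclidean norm. -/
abbrev Cn (n : ℕ) : Type := EuclideanSpace ℂ (Fin n)

/-- The Kobayashi (infinitesimal) metric `F_K(Q, X)` of `Ω ⊆ ℂⁿ`: the infimum of all `α > 0` such
that some holomorphic map `φ` from the unit disc to `Ω` has `φ(0) = Q` and `φ'(0) = X / α`. -/
def kobayashiMetric {n : ℕ} (Ω : Set (Cn n)) (Q X : Cn n) : ℝ :=
  sInf {α : ℝ | 0 < α ∧ ∃ φ : ℂ → Cn n,
    DifferentiableOn ℂ φ (ball 0 1) ∧ MapsTo φ (ball 0 1) Ω ∧ φ 0 = Q ∧ deriv φ 0 = α⁻¹ • X}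

/-- `Ω ⊂⊂ ℂⁿ` is a bounded domain with `C^∞` boundary, and `r` is a `C^∞` defining function:
`Ω = {r < 0}` and the gradient of `r` does not vanish on `{r = 0}` (which is then `∂Ω`). -/
structure IsSmoothlyBoundedDomain {n : ℕ} (Ω : Set (Cn n)) (r : Cn n → ℝ) : Prop where
  isConnected : IsConnected Ω
  isBounded : Bornology.IsBounded Ω
  contDiff : ContDiff ℝ ∞ r
  eq_sublevel : Ω = {x | r x < 0}
  gradient_ne_zero : ∀ x, r x = 0 → ∇ r x ≠ 0

/-- The unit outward normal `∇r(P) / ‖∇r(P)‖` at the boundary point `P` of `{r < 0}`. -/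
def unitOutwardNormal {n : ℕ} (r : Cn n → ℝ) (P : Cn n) : Cn n :=
  ‖∇ r P‖⁻¹ • ∇ r P

/-- The Levi form (complex Hessian) `∑ⱼₖ ∂²f/∂zⱼ∂z̄ₖ (p) vⱼ v̄ₖ` of a `C²` function, written through
the real second derivative as `(D²f(p)(v, v) + D²f(p)(iv, iv)) / 4`. -/
def leviForm {n : ℕ} (f : Cn n → ℝ) (p v : Cn n) : ℝ :=
  (fderiv ℝ (fderiv ℝ f) p v v
    + fderiv ℝ (fderiv ℝ f) p (Complex.I • v) (Complex.I • v)) / 4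

/-- (Levi) pseudoconvexity of the smooth domain `{r < 0}`: at every boundary point the Levi form of
`r` is nonnegative on the complex tangent space of the boundary, i.e. on the vectors `v` for which
both `v` and `i v` are tangent to the boundary. -/
def IsLeviPseudoconvex {n : ℕ} (Ω : Set (Cn n)) (r : Cn n → ℝ) : Prop :=
  ∀ p ∈ frontier Ω, ∀ v : Cn n,
    fderiv ℝ r p v = 0 → fderiv ℝ r p (Complex.I • v) = 0 → 0 ≤ leviForm r p v

/-- The order of vanishing at `0` of a function on `ℂ` that is smooth near `0`:
the largest `k` with `f(ζ) = O(|ζ|ᵏ)` as `ζ → 0`, and `⊤` if there is no largest one. -/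
def vanishingOrder {F : Type*} [NormedAddCommGroup F] (f : ℂ → F) : ℕ∞ :=
  ⨆ k ∈ {k : ℕ | f =O[𝓝 0] fun ζ : ℂ => ‖ζ‖ ^ k}, (k : ℕ∞)

/-- The D'Angelo type at `P` of the hypersurface `{r = 0}`: the supremum, over all nonconstant germs
`γ : (ℂ, 0) → (ℂⁿ, P)` of holomorphic curves, of the order of vanishing of `r ∘ γ` divided by the
order of vanishing of `γ - P`. -/
def dAngeloType {n : ℕ} (r : Cn n → ℝ) (P : Cn n) : ℝ≥0∞ :=
  ⨆ γ ∈ {γ : ℂ → Cn n | AnalyticAt ℂ γ 0 ∧ γ 0 = P ∧ ¬ ∀ᶠ ζ in 𝓝 0, γ ζ = P},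
    (vanishingOrder (fun ζ => r (γ ζ)) : ℝ≥0∞) / (vanishingOrder (fun ζ => γ ζ - P) : ℝ≥0∞)

end

/-! The upper bound comes from discs whose `(s, t)`-part runs along a cusp `(c²ζ², c³ζ³)`. Both
components have zero derivative at `ζ = 0`, so `ζ ↦ (c²ζ², c³ζ³, -δ + aδζ)` starts at `-δν` with
velocity `aδν`. It gives `F_K ≤ 1/(aδ)` once `ρ < δ(1 - a Re ζ)` on the cusp. One flat
plurisubharmonic `ρ` must achieve this for all pairs `(aₙ, δₙ)`.

For one cusp (`exists_psh_on_cusp`), split `exp(-Aζ) = C(ζ²) - ζ S(ζ²)`. Then `f = s C(s) - t S(s)`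
restricts to `ζ² exp(-Aζ)` on the unit cusp, and `K log |f|` with `KA = a` restricts to `2K log |ζ|
- a Re ζ`, which has the required slope. Adding the square of a multiple of `s³ - t²` inside the
logarithm leaves the cusp values unchanged and confines the singularity to the origin. A convex ramp
then replaces the logarithm by `0` near the origin.

For all cusps at once (`exists_flat_psh_on_cusps`), the `n`-th cusp is shrunk into the region where
all earlier functions vanish, and the coefficients `δₙ` decay so fast that later functions are
negligible on it. The weighted sum is smooth, flat at `0`, and has small Lipschitz constant.

The domain is a small perturbation by `ρ` of a convex model that equals `Re w` in the unit ball and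
is positive far out. Smallness of the perturbation gives connectedness and a nonzero gradient;
flatness gives infinite type. -/

/-! ### The smooth convex ramp -/

/-- A smooth convex monotone function vanishing for `x ≤ 0` and affine of slope `1` for `x ≥ 1`. -/
noncomputable def smoothRamp (x : ℝ) : ℝ := ∫ t in (0 : ℝ)..x, Real.smoothTransition t

namespace smoothRamp

theorem hasDerivAt (x : ℝ) : HasDerivAt smoothRamp (Real.smoothTransition x) x :=
  intervalIntegral.integral_hasDerivAt_right
    (Real.smoothTransition.continuous.intervalIntegrable _ _)
    Real.smoothTransition.continuous.stronglyMeasurable.stronglyMeasurableAtFilter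
    Real.smoothTransition.continuousAt

theorem deriv_eq : deriv smoothRamp = Real.smoothTransition :=
  funext fun x => (hasDerivAt x).deriv

theorem contDiff : ContDiff ℝ ∞ smoothRamp := by
  rw [contDiff_infty_iff_deriv, deriv_eq]
  exact ⟨fun x => (hasDerivAt x).differentiableAt, Real.smoothTransition.contDiff⟩

theorem monotone : Monotone smoothRamp :=
  monotone_of_deriv_nonneg (fun x => (hasDerivAt x).differentiableAt)
    fun x => by rw [deriv_eq]; exact Real.smoothTransition.nonneg x

theorem convexOn : ConvexOn ℝ univ smoothRamp :=
  MonotoneOn.convexOn_of_deriv convex_univ contDiff.continuous.continuousOn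
    (contDiff.differentiable (by simp)).differentiableOn
    (by rw [deriv_eq]; exact Real.smoothTransition.monotone.monotoneOn _)

theorem of_nonpos {x : ℝ} (hx : x ≤ 0) : smoothRamp x = 0 := by
  unfold smoothRamp
  rw [intervalIntegral.integral_congr (g := fun _ => (0 : ℝ))]
  · simp
  · intro t ht
    rw [uIcc_of_ge hx] at ht
    exact Real.smoothTransition.zero_of_nonpos ht.2

theorem nonneg (x : ℝ) : 0 ≤ smoothRamp x := by
  rcases le_total x 0 with h | h
  · exact (of_nonpos h).ge
  · simpa [of_nonpos le_rfl] using monotone h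

theorem sub_le {x y : ℝ} (h : x ≤ y) : smoothRamp y - smoothRamp x ≤ y - x := by
  have := (convex_univ (𝕜 := ℝ) (E := ℝ)).image_sub_le_mul_sub_of_deriv_le
    (f := smoothRamp) (C := 1) contDiff.continuous.continuousOn
    (contDiff.differentiable (by simp)).differentiableOn
    (fun x _ => by rw [deriv_eq]; exact Real.smoothTransition.le_one x) x trivial y trivial h
  simpa using this

theorem of_one_le {x : ℝ} (hx : 1 ≤ x) : smoothRamp x = x - (1 - smoothRamp 1) := by
  have h : ∫ t in (1 : ℝ)..x, Real.smoothTransition t = x - 1 := by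
    rw [intervalIntegral.integral_congr (g := fun _ => (1 : ℝ))]
    · simp
    · intro t ht
      rw [uIcc_of_le hx] at ht
      exact Real.smoothTransition.one_of_one_le ht.1
  have := intervalIntegral.integral_add_adjacent_intervals
    (Real.smoothTransition.continuous.intervalIntegrable (μ := MeasureTheory.volume) 0 1)
    (Real.smoothTransition.continuous.intervalIntegrable (μ := MeasureTheory.volume) 1 x)
  unfold smoothRamp
  linarith

theorem one_le_one : smoothRamp 1 ≤ 1 := by
  have := sub_le (zero_le_one' ℝ)
  rw [of_nonpos le_rfl] at this
  linarith

theorem le_max (x : ℝ) : smoothRamp x ≤ max x 0 := by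
  rcases le_total x 0 with h | h
  · rw [of_nonpos h]; exact le_max_right _ _
  · have := sub_le h
    rw [of_nonpos le_rfl] at this
    exact le_max_of_le_left (by linarith)

/-- A convex function lies above its tangents. -/
theorem tangent_le (x y : ℝ) :
    smoothRamp x + Real.smoothTransition x * (y - x) ≤ smoothRamp y := by
  rcases lt_trichotomy x y with h | rfl | h
  · have := convexOn.le_slope_of_hasDerivAt (mem_univ x) (mem_univ y) h (hasDerivAt x)
    rw [slope_def_field, le_div_iff₀ (by linarith)] at this
    linarith
  · simp
  · have := convexOn.slope_le_of_hasDerivAt (mem_univ y) (mem_univ x) h (hasDerivAt x)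
    rw [slope_def_field, div_le_iff₀ (by linarith)] at this
    linarith

end smoothRamp

/-! ### Levi forms and touching from below -/

/-- The second-derivative test, necessary direction. -/
theorem IsLocalMin.deriv_deriv_nonneg {f : ℝ → ℝ} {x : ℝ} (h : IsLocalMin f x)
    (hc : ContinuousAt f x) : 0 ≤ deriv (deriv f) x := by
  by_contra! hlt
  have hmax := isLocalMax_of_deriv_deriv_neg hlt h.deriv_eq_zero hc
  have hconst : f =ᶠ[𝓝 x] fun _ => f x := by
    filter_upwards [h, hmax] with y h1 h2 using le_antisymm h2 h1
  have := hconst.deriv.deriv.eq_of_nhds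
  simp at this
  linarith

theorem deriv_deriv_along_line {E : Type*} [NormedAddCommGroup E] [NormedSpace ℝ E] {f : E → ℝ}
    {p : E} (hf : ContDiffAt ℝ 2 f p) (v : E) :
    deriv (deriv fun t : ℝ => f (p + t • v)) 0 = fderiv ℝ (fderiv ℝ f) p v v := by
  have hl : ∀ t : ℝ, HasDerivAt (fun t : ℝ => p + t • v) v t := fun t => by
    simpa using ((hasDerivAt_id t).smul_const v).const_add p
  have hc : Tendsto (fun t : ℝ => p + t • v) (𝓝 0) (𝓝 p) := by
    have := (hl 0).continuousAt.tendsto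
    rwa [zero_smul, add_zero] at this
  have hev : ∀ᶠ q in 𝓝 p, ContDiffAt ℝ 2 f q := hf.eventually (by simp)
  have h1 : (deriv fun t : ℝ => f (p + t • v)) =ᶠ[𝓝 0] fun t => fderiv ℝ f (p + t • v) v := by
    filter_upwards [hc.eventually hev] with t ht
    exact ((ht.differentiableAt (by simp)).hasFDerivAt.comp_hasDerivAt t (hl t)).deriv
  rw [h1.deriv_eq]
  have h2 : DifferentiableAt ℝ (fderiv ℝ f) p :=
    (hf.fderiv_right (m := 1) (by norm_num)).differentiableAt (by simp)
  have h3 : HasDerivAt (fun t : ℝ => fderiv ℝ f (p + t • v)) (fderiv ℝ (fderiv ℝ f) p v) 0 :=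
    h2.hasFDerivAt.comp_hasDerivAt_of_eq (0 : ℝ) (hl 0) (by simp)
  have h4 := h3.clm_apply (hasDerivAt_const (0 : ℝ) v)
  rw [h4.deriv, map_zero, add_zero]

theorem hasDerivAt_re_comp_smul {G : ℂ → ℂ} {c : ℂ} {t : ℝ} (hG : DifferentiableAt ℂ G (t • c)) :
    HasDerivAt (fun t : ℝ => (G (t • c)).re) (deriv G (t • c) * c).re t := by
  have h1 : HasDerivAt (fun t : ℝ => t • c) c t := by
    simpa using (hasDerivAt_id t).smul_const c
  have h2 : HasDerivAt (fun t : ℝ => G (t • c)) (deriv G (t • c) * c) t :=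
    HasDerivAt.comp_of_eq (h := fun t : ℝ => t • c) t hG.hasDerivAt h1 rfl
  exact Complex.reCLM.hasFDerivAt.comp_hasDerivAt t h2

theorem deriv_deriv_re_along_line {G : ℂ → ℂ} (hG : AnalyticAt ℂ G 0) (c : ℂ) :
    deriv (deriv fun t : ℝ => (G (t • c)).re) 0 = (deriv (deriv G) 0 * c * c).re := by
  have hc : ContinuousAt (fun t : ℝ => t • c) 0 := by fun_prop
  have h1 : (deriv fun t : ℝ => (G (t • c)).re) =ᶠ[𝓝 0]
      fun t => ((fun z => deriv G z * c) (t • c)).re := by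
    have : ∀ᶠ t : ℝ in 𝓝 0, AnalyticAt ℂ G (t • c) :=
      hc.eventually (by simpa using hG.eventually_analyticAt)
    filter_upwards [this] with t ht
    exact (hasDerivAt_re_comp_smul ht.differentiableAt).deriv
  rw [h1.deriv_eq]
  have h2 : DifferentiableAt ℂ (fun z => deriv G z * c) ((0 : ℝ) • c) := by
    simpa using hG.deriv.differentiableAt.mul_const c
  rw [(hasDerivAt_re_comp_smul h2).deriv]
  have h3 : deriv (fun z => deriv G z * c) 0 = deriv (deriv G) 0 * c :=
    (hG.deriv.differentiableAt.hasDerivAt.mul_const c).deriv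
  simp [h3]

/-- A `C²` function touched from below at `p` by the real part of a holomorphic function, along
every complex line, has nonnegative Levi form at `p`. -/
theorem leviForm_nonneg_of_touching {n : ℕ} {f : Cn n → ℝ} {p v : Cn n}
    (hf : ContDiffAt ℝ 2 f p) {G : ℂ → ℂ} (hG : AnalyticAt ℂ G 0) (h0 : (G 0).re = f p)
    (hle : ∀ᶠ z : ℂ in 𝓝 0, (G z).re ≤ f (p + z • v)) : 0 ≤ leviForm f p v := by
  have key : ∀ c : ℂ, (deriv (deriv G) 0 * c * c).re ≤ fderiv ℝ (fderiv ℝ f) p (c • v) (c • v) := by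
    intro c
    have hc : ContinuousAt (fun t : ℝ => t • c) 0 := by fun_prop
    have hl : ContDiff ℝ 2 (fun t : ℝ => p + t • (c • v)) := by fun_prop
    have hf' : ContDiffAt ℝ 2 (fun t : ℝ => f (p + t • (c • v))) 0 :=
      ContDiffAt.comp (0 : ℝ) (by simpa using hf) hl.contDiffAt
    have hGR : ContDiffAt ℝ 2 (fun t : ℝ => (G (t • c)).re) 0 := by
      have h1 : ContDiffAt ℝ 2 G ((0 : ℝ) • c) := by
        simpa using (hG.contDiffAt (n := 2)).restrict_scalars ℝ
      have h2 : ContDiff ℝ 2 (fun t : ℝ => t • c) := by fun_prop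
      exact Complex.reCLM.contDiff.contDiffAt.comp (0 : ℝ)
        (ContDiffAt.comp (0 : ℝ) h1 h2.contDiffAt)
    have hmin : IsLocalMin (fun t : ℝ => f (p + t • (c • v)) - (G (t • c)).re) 0 := by
      have := hc.eventually (p := fun z : ℂ => (G z).re ≤ f (p + z • v)) (by simpa using hle)
      filter_upwards [this] with t ht
      simp only [zero_smul, add_zero, h0, sub_self, sub_nonneg]
      rwa [smul_assoc] at ht
    have hd := hmin.deriv_deriv_nonneg (hf'.sub hGR).continuousAt
    have e1 : deriv (fun t : ℝ => f (p + t • (c • v)) - (G (t • c)).re) =ᶠ[𝓝 0]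
        fun t => deriv (fun t : ℝ => f (p + t • (c • v))) t
          - deriv (fun t : ℝ => (G (t • c)).re) t := by
      filter_upwards [hf'.eventually (by simp), hGR.eventually (by simp)] with t h1 h2
      exact deriv_fun_sub (h1.differentiableAt (by simp)) (h2.differentiableAt (by simp))
    have d1 : ∀ {g : ℝ → ℝ}, ContDiffAt ℝ 2 g 0 → DifferentiableAt ℝ (deriv g) 0 := by
      intro g hg
      have := (hg.fderiv_right (m := 1) (by norm_num)).differentiableAt (by simp)
      exact this.clm_apply (differentiableAt_const (1 : ℝ))
    rw [e1.deriv_eq, deriv_fun_sub (d1 hf') (d1 hGR), deriv_deriv_along_line hf,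
      deriv_deriv_re_along_line hG] at hd
    linarith
  -- The directions `1` and `i` contribute `Re G''(0)` and `-Re G''(0)`, which cancel in the Levi
  -- form.
  have k1 := key 1
  have k2 := key Complex.I
  simp only [mul_one, one_smul] at k1
  rw [mul_assoc, Complex.I_mul_I] at k2
  simp only [mul_neg, mul_one, Complex.neg_re] at k2
  unfold leviForm
  linarith

theorem leviForm_congr {n : ℕ} {f g : Cn n → ℝ} {p : Cn n} (h : f =ᶠ[𝓝 p] g) (v : Cn n) :
    leviForm f p v = leviForm g p v := by
  unfold leviForm
  rw [h.fderiv.fderiv_eq]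

theorem leviForm_comp_clm {m n : ℕ} {f : Cn n → ℝ} (T : Cn m →L[ℂ] Cn n) {p : Cn m}
    (hf : ContDiffAt ℝ 2 f (T p)) (v : Cn m) :
    leviForm (fun x => f (T x)) p v = leviForm f (T p) (T v) := by
  have hT : ContDiff ℝ 2 T := T.contDiff.restrict_scalars ℝ
  have hfT : ContDiffAt ℝ 2 (fun x => f (T x)) p := ContDiffAt.comp p hf hT.contDiffAt
  have hr : ∀ (t : ℝ) x, T (t • x) = t • T x := fun t x => T.map_smul_of_tower t x
  have key : ∀ w, fderiv ℝ (fderiv ℝ (fun x => f (T x))) p w w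
      = fderiv ℝ (fderiv ℝ f) (T p) (T w) (T w) := by
    intro w
    rw [← deriv_deriv_along_line hfT, ← deriv_deriv_along_line hf]
    simp [hr]
  unfold leviForm
  rw [key, key, map_smul]

theorem leviForm_add {n : ℕ} {f g : Cn n → ℝ} {p : Cn n} (hf : ContDiffAt ℝ 2 f p)
    (hg : ContDiffAt ℝ 2 g p) (v : Cn n) :
    leviForm (fun x => f x + g x) p v = leviForm f p v + leviForm g p v := by
  have e : fderiv ℝ (fun x => f x + g x) =ᶠ[𝓝 p] fun x => fderiv ℝ f x + fderiv ℝ g x := by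
    filter_upwards [hf.eventually (by simp), hg.eventually (by simp)] with x h1 h2
    exact fderiv_fun_add (h1.differentiableAt (by simp)) (h2.differentiableAt (by simp))
  have d : ∀ {g : Cn n → ℝ}, ContDiffAt ℝ 2 g p → DifferentiableAt ℝ (fderiv ℝ g) p :=
    fun hg => (hg.fderiv_right (m := 1) (by norm_num)).differentiableAt (by simp)
  unfold leviForm
  rw [e.fderiv_eq, fderiv_fun_add (d hf) (d hg)]
  simp only [add_apply]
  ring

/-- The Levi form through the second iterated derivative. -/
theorem leviForm_eq_iteratedFDeriv {n : ℕ} (f : Cn n → ℝ) (p v : Cn n) :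
    leviForm f p v = (iteratedFDeriv ℝ 2 f p ![v, v]
      + iteratedFDeriv ℝ 2 f p ![Complex.I • v, Complex.I • v]) / 4 := by
  simp [leviForm, iteratedFDeriv_two_apply]

/-- A differentiable convex function lies above its tangents. -/
theorem ConvexOn.add_fderiv_le {E : Type*} [NormedAddCommGroup E] [NormedSpace ℝ E] {f : E → ℝ}
    (hf : ConvexOn ℝ univ f) {p : E} (hd : DifferentiableAt ℝ f p) (v : E) :
    f p + fderiv ℝ f p v ≤ f (p + v) := by
  have hl : HasDerivAt (fun t : ℝ => p + t • v) v 0 := by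
    simpa using ((hasDerivAt_id (0 : ℝ)).smul_const v).const_add p
  have h1 : HasDerivAt (fun t : ℝ => f (p + t • v)) (fderiv ℝ f p v) 0 :=
    hd.hasFDerivAt.comp_hasDerivAt_of_eq (0 : ℝ) hl (by simp)
  have h2 : ConvexOn ℝ univ (fun t : ℝ => f (p + t • v)) := by
    have := hf.comp_affineMap (AffineMap.lineMap p (p + v) : ℝ →ᵃ[ℝ] E)
    rw [preimage_univ] at this
    have e : f ∘ (AffineMap.lineMap p (p + v) : ℝ →ᵃ[ℝ] E) = fun t : ℝ => f (p + t • v) := by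
      ext t
      simp [AffineMap.lineMap_apply, add_comm]
    rwa [e] at this
  have := h2.le_slope_of_hasDerivAt (mem_univ 0) (mem_univ 1) one_pos h1
  simp [slope_def_field] at this
  linarith

/-- A `C²` convex function has nonnegative Levi form. -/
theorem ConvexOn.leviForm_nonneg {n : ℕ} {f : Cn n → ℝ} (hf : ConvexOn ℝ univ f) {p : Cn n}
    (hd : ContDiffAt ℝ 2 f p) (v : Cn n) : 0 ≤ leviForm f p v := by
  have hd1 := hd.differentiableAt (by simp)
  -- The real tangent of `f` along the complex line is the real part of an affine holomorphic
  -- function.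
  refine leviForm_nonneg_of_touching hd (G := fun z => f p
    + (fderiv ℝ f p v - fderiv ℝ f p (Complex.I • v) * Complex.I) * z) ?_ (by simp) ?_
  · exact Differentiable.analyticAt (by fun_prop) 0
  · refine Eventually.of_forall fun z => le_trans (le_of_eq ?_) (hf.add_fderiv_le hd1 (z • v))
    have : z • v = z.re • v + z.im • (Complex.I • v) := by
      conv_lhs => rw [← Complex.re_add_im z, add_smul, mul_smul]
      rfl
    generalize hw : Complex.I • v = w at *
    rw [this, map_add, map_smul, map_smul]
    simp
    ring

/-! ### Logarithms of sums of squared moduli -/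

/-- `(K / 2) log (|f|² + |g|²) + c`. -/
noncomputable def logNormSq {n : ℕ} (f g : Cn n → ℂ) (K c : ℝ) (z : Cn n) : ℝ :=
  K / 2 * Real.log (‖f z‖ ^ 2 + ‖g z‖ ^ 2) + c

theorem contDiff_normSq_add {n : ℕ} {f g : Cn n → ℂ} (hf : ContDiff ℂ ∞ f) (hg : ContDiff ℂ ∞ g) :
    ContDiff ℝ ∞ fun z => ‖f z‖ ^ 2 + ‖g z‖ ^ 2 :=
  ((hf.restrict_scalars ℝ).norm_sq ℝ).add ((hg.restrict_scalars ℝ).norm_sq ℝ)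

theorem contDiffAt_logNormSq {n : ℕ} {f g : Cn n → ℂ} (hf : ContDiff ℂ ∞ f) (hg : ContDiff ℂ ∞ g)
    (K c : ℝ) {p : Cn n} (hp : 0 < ‖f p‖ ^ 2 + ‖g p‖ ^ 2) :
    ContDiffAt ℝ ∞ (logNormSq f g K c) p :=
  (contDiffAt_const.mul ((contDiff_normSq_add hf hg).contDiffAt.log hp.ne')).add contDiffAt_const

/-- Where `f` and `g` do not both vanish, `log (|f|² + |g|²)` is touched from below by the logarithm
of the modulus of a holomorphic linear combination of `f` and `g`. -/
theorem exists_touching_logNormSq {n : ℕ} {f g : Cn n → ℂ} (hf : ContDiff ℂ ∞ f)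
    (hg : ContDiff ℂ ∞ g) {K : ℝ} (hK : 0 ≤ K) (c : ℝ) {p : Cn n}
    (hp : 0 < ‖f p‖ ^ 2 + ‖g p‖ ^ 2) (v : Cn n) :
    ∃ G : ℂ → ℂ, AnalyticAt ℂ G 0 ∧ (G 0).re = logNormSq f g K c p ∧
      ∀ᶠ z : ℂ in 𝓝 0, (G z).re ≤ logNormSq f g K c (p + z • v) := by
  set X : Cn n → ℝ := fun z => ‖f z‖ ^ 2 + ‖g z‖ ^ 2 with hX
  have hXp : 0 < X p := hp
  -- Conjugate weights make Cauchy–Schwarz `|u|² ≤ X(p) X(p + zv)` an equality at `z = 0`, so `K log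
  -- |u|` touches after normalisation.
  let u : ℂ → ℂ := fun z =>
    (starRingEnd ℂ) (f p) * f (p + z • v) + (starRingEnd ℂ) (g p) * g (p + z • v)
  have hu0 : u 0 = (X p : ℂ) := by
    simp [u, hX, Complex.conj_mul']
  have hfd : Differentiable ℂ f := hf.differentiable (by simp)
  have hgd : Differentiable ℂ g := hg.differentiable (by simp)
  have hud : Differentiable ℂ u := by
    have hl : Differentiable ℂ fun z : ℂ => p + z • v := by fun_prop
    exact ((hfd.comp hl).const_mul _).add ((hgd.comp hl).const_mul _)
  have hslit : u 0 ∈ Complex.slitPlane := by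
    rw [hu0]; exact Complex.ofReal_mem_slitPlane.2 hXp
  have hCS : ∀ z, ‖u z‖ ^ 2 ≤ X p * X (p + z • v) := by
    intro z
    have h1 : ‖u z‖ ≤ ‖f p‖ * ‖f (p + z • v)‖ + ‖g p‖ * ‖g (p + z • v)‖ := by
      refine (norm_add_le _ _).trans (le_of_eq ?_)
      simp
    have h2 := pow_le_pow_left₀ (norm_nonneg _) h1 2
    simp only [hX]
    nlinarith [sq_nonneg (‖f p‖ * ‖g (p + z • v)‖ - ‖g p‖ * ‖f (p + z • v)‖)]
  refine ⟨fun z => K * Complex.log (u z) - ((K / 2 * Real.log (X p) - c : ℝ) : ℂ), ?_, ?_, ?_⟩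
  · exact (analyticAt_const.mul ((hud.analyticAt 0).clog hslit)).sub analyticAt_const
  · simp only [Complex.sub_re, Complex.re_ofReal_mul, Complex.log_re, Complex.ofReal_re, hu0,
      Complex.norm_real, Real.norm_of_nonneg hXp.le, logNormSq]
    simp only [hX]
    ring
  · have hne : ∀ᶠ z in 𝓝 0, u z ∈ Complex.slitPlane :=
      hud.continuous.continuousAt.eventually (Complex.isOpen_slitPlane.mem_nhds hslit)
    filter_upwards [hne] with z hz
    have hz0 : 0 < ‖u z‖ := norm_pos_iff.2 (Complex.slitPlane_ne_zero hz)
    have hXz : 0 < X (p + z • v) := by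
      have := hCS z
      by_contra! h
      nlinarith [pow_pos hz0 2]
    have hl := Real.log_le_log (pow_pos hz0 2) (hCS z)
    rw [Real.log_pow, Real.log_mul hXp.ne' hXz.ne'] at hl
    simp only [Complex.sub_re, Complex.re_ofReal_mul, Complex.log_re, Complex.ofReal_re, logNormSq]
    change _ ≤ K / 2 * Real.log (X (p + z • v)) + c
    push_cast at hl
    nlinarith

theorem leviForm_logNormSq_nonneg {n : ℕ} {f g : Cn n → ℂ} (hf : ContDiff ℂ ∞ f)
    (hg : ContDiff ℂ ∞ g) {K : ℝ} (hK : 0 ≤ K) (c : ℝ) {p : Cn n}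
    (hp : 0 < ‖f p‖ ^ 2 + ‖g p‖ ^ 2) (v : Cn n) : 0 ≤ leviForm (logNormSq f g K c) p v := by
  obtain ⟨G, hG, h0, hle⟩ := exists_touching_logNormSq hf hg hK c hp v
  exact leviForm_nonneg_of_touching ((contDiffAt_logNormSq hf hg K c hp).of_le (WithTop.coe_le_coe.2 (le_top (a := (2 : ℕ∞))))) hG h0 hle

theorem contDiffAt_smoothRamp_logNormSq {n : ℕ} {f g : Cn n → ℂ} (hf : ContDiff ℂ ∞ f)
    (hg : ContDiff ℂ ∞ g) (K c : ℝ) {p : Cn n} (hp : 0 < ‖f p‖ ^ 2 + ‖g p‖ ^ 2) :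
    ContDiffAt ℝ ∞ (fun z => smoothRamp (logNormSq f g K c z)) p :=
  smoothRamp.contDiff.contDiffAt.comp p (contDiffAt_logNormSq hf hg K c hp)

/-- The tangent to the ramp at `U p` has nonnegative slope, so composing it with the touching
function of `U` gives one for the composite. -/
theorem leviForm_smoothRamp_logNormSq_nonneg {n : ℕ} {f g : Cn n → ℂ} (hf : ContDiff ℂ ∞ f)
    (hg : ContDiff ℂ ∞ g) {K : ℝ} (hK : 0 ≤ K) (c : ℝ) {p : Cn n}
    (hp : 0 < ‖f p‖ ^ 2 + ‖g p‖ ^ 2) (v : Cn n) :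
    0 ≤ leviForm (fun z => smoothRamp (logNormSq f g K c z)) p v := by
  obtain ⟨G, hG, h0, hle⟩ := exists_touching_logNormSq hf hg hK c hp v
  set U := logNormSq f g K c
  refine leviForm_nonneg_of_touching
    ((contDiffAt_smoothRamp_logNormSq hf hg K c hp).of_le (WithTop.coe_le_coe.2 (le_top (a := (2 : ℕ∞)))))
    (G := fun z => ((smoothRamp (U p) : ℝ) : ℂ)
      + (Real.smoothTransition (U p) : ℂ) * (G z - (U p : ℂ))) ?_ ?_ ?_
  · exact analyticAt_const.add (analyticAt_const.mul (hG.sub analyticAt_const))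
  · simp [h0]
  · filter_upwards [hle] with z hz
    refine le_trans ?_ (smoothRamp.tangent_le (U p) (U (p + z • v)))
    simp only [Complex.add_re, Complex.re_ofReal_mul, Complex.sub_re, Complex.ofReal_re]
    gcongr
    exact Real.smoothTransition.nonneg _

/-! ### A plurisubharmonic function adapted to one cusp -/

theorem differentiable_tsum_pow_of_norm_le {c : ℕ → ℂ} {M B : ℝ}
    (hc : ∀ n, ‖c n‖ ≤ M * (B ^ n / n.factorial)) :
    Differentiable ℂ fun s : ℂ => ∑' n, c n * s ^ n := by
  have hball : ∀ R : ℝ, DifferentiableOn ℂ (fun s : ℂ => ∑' n, c n * s ^ n) (ball 0 R) := by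
    intro R
    refine Complex.differentiableOn_tsum_of_summable_norm
      (u := fun n => M * ((B * R) ^ n / n.factorial))
      ((Real.summable_pow_div_factorial (B * R)).mul_left M) (fun n => by fun_prop) isOpen_ball ?_
    intro n s hs
    have hs' : ‖s‖ ≤ R := by simpa using (mem_ball_zero_iff.1 hs).le
    rw [norm_mul, norm_pow]
    calc ‖c n‖ * ‖s‖ ^ n ≤ M * (B ^ n / n.factorial) * R ^ n :=
          mul_le_mul (hc n) (by gcongr) (by positivity) ((norm_nonneg _).trans (hc n))
      _ = _ := by rw [mul_pow]; ring
  intro s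
  exact (hball (‖s‖ + 1)).differentiableAt (isOpen_ball.mem_nhds (by simp))

/-- The even and odd parts of the exponential function, as entire functions of `ζ²`. -/
theorem exists_entire_exp_neg_eq (A : ℝ) :
    ∃ C S : ℂ → ℂ, Differentiable ℂ C ∧ Differentiable ℂ S ∧
      ∀ ζ : ℂ, C (ζ ^ 2) - ζ * S (ζ ^ 2) = Complex.exp (-(A * ζ)) := by
  have hfac : ∀ n m : ℕ, n ≤ m → ∀ x : ℝ, 0 ≤ x → x / m.factorial ≤ x / n.factorial := by
    intro n m h x hx
    gcongr
  have hnorm : ∀ n m : ℕ, ‖(A : ℂ) ^ n / (m.factorial : ℂ)‖ = |A| ^ n / m.factorial := by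
    intro n m
    simp
  refine ⟨fun s => ∑' n : ℕ, (A : ℂ) ^ (2 * n) / ((2 * n).factorial : ℂ) * s ^ n,
    fun s => ∑' n : ℕ, (A : ℂ) ^ (2 * n + 1) / ((2 * n + 1).factorial : ℂ) * s ^ n, ?_, ?_, ?_⟩
  · refine differentiable_tsum_pow_of_norm_le (M := 1) (B := |A| ^ 2) fun n => ?_
    rw [hnorm, one_mul, ← pow_mul]
    exact hfac _ _ (by omega) _ (by positivity)
  · refine differentiable_tsum_pow_of_norm_le (M := |A|) (B := |A| ^ 2) fun n => ?_
    rw [hnorm, ← pow_mul, ← mul_div_assoc, pow_succ, mul_comm]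
    exact hfac _ _ (by omega) _ (by positivity)
  · intro ζ
    rw [← Complex.cosh_sub_sinh, Complex.cosh_eq_tsum, Complex.sinh_eq_tsum, ← tsum_mul_left]
    congr 1
    · exact tsum_congr fun n => by rw [mul_pow, ← pow_mul]; ring
    · exact tsum_congr fun n => by rw [mul_pow, ← pow_mul]; ring

/-- Away from the origin, `f = s C(s) - t S(s)` and a large multiple of `s³ - t²` are not both
small, when `f` is bounded below on the cusp `s³ = t²`. -/
theorem exists_cusp_lower_bound {C S : ℂ → ℂ} (hS : Continuous S) {A z₀ : ℝ} (hA : 0 ≤ A)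
    (hz₀ : 0 < z₀) (hCS : ∀ ζ : ℂ, C (ζ ^ 2) - ζ * S (ζ ^ 2) = Complex.exp (-(A * ζ))) :
    ∃ N : ℝ, 0 < N ∧ ∀ s t : ℂ, z₀ ^ 2 / 2 ≤ ‖s‖ → ‖s‖ ≤ z₀ ^ 2 →
      (z₀ ^ 2 / 4 * Real.exp (-(A * z₀))) ^ 2
        ≤ ‖s * C s - t * S s‖ ^ 2 + ‖(N : ℂ) * (s ^ 3 - t ^ 2)‖ ^ 2 := by
  obtain ⟨M', hM'⟩ := (isCompact_closedBall (0 : ℂ) (z₀ ^ 2)).exists_bound_of_continuousOn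
    hS.continuousOn
  set M := max M' 1
  have hM : ∀ s : ℂ, ‖s‖ ≤ z₀ ^ 2 → ‖S s‖ ≤ M := fun s hs =>
    (hM' s (by simpa using hs)).trans (le_max_left _ _)
  have hM0 : 0 < M := lt_of_lt_of_le one_pos (le_max_right _ _)
  set m := z₀ ^ 2 / 4 * Real.exp (-(A * z₀)) with hm
  have hm0 : 0 < m := by positivity
  -- Either `t` is within `m/M` of a cusp value `ζ³`, and `f` loses at most `m` from its cusp
  -- modulus, which is at least `2m`, or `|s³ - t²| ≥ (m/M)²`, which this factor scales up to `m`.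
  refine ⟨m / (m / M) ^ 2, by positivity, fun s t hs1 hs2 => ?_⟩
  -- Taking the square root whose cube is nearer to `t` bounds both factors of `t² - s³` below by
  -- `|t - ζ³|`.
  obtain ⟨ζ, hζ, hle⟩ : ∃ ζ : ℂ, ζ ^ 2 = s ∧ ‖t - ζ ^ 3‖ ≤ ‖t + ζ ^ 3‖ := by
    obtain ⟨ζ, hζ⟩ := IsAlgClosed.exists_pow_nat_eq s two_pos
    rcases le_total ‖t - ζ ^ 3‖ ‖t + ζ ^ 3‖ with h | h
    · exact ⟨ζ, hζ, h⟩
    · refine ⟨-ζ, by rw [neg_sq, hζ], ?_⟩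
      rwa [Odd.neg_pow (by decide), sub_neg_eq_add, ← sub_eq_add_neg]
  have hnz : ‖ζ‖ ≤ z₀ := by
    rw [← hζ, norm_pow] at hs2
    exact le_of_sq_le_sq hs2 hz₀.le
  rcases le_total (‖t - ζ ^ 3‖ * M) m with h | h
  · have e : s * C s - t * S s = ζ ^ 2 * Complex.exp (-(A * ζ)) - (t - ζ ^ 3) * S s := by
      rw [← hCS, ← hζ]; ring
    have h1 : 2 * m ≤ ‖ζ ^ 2 * Complex.exp (-(A * ζ))‖ := by
      rw [norm_mul, hζ, Complex.norm_exp]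
      have h3 : Real.exp (-(A * z₀)) ≤ Real.exp ((-(A * ζ)).re) := by
        apply Real.exp_le_exp.2
        simp only [Complex.neg_re, Complex.re_ofReal_mul, neg_le_neg_iff]
        exact mul_le_mul_of_nonneg_left ((Complex.re_le_norm ζ).trans hnz) hA
      calc 2 * m = z₀ ^ 2 / 2 * Real.exp (-(A * z₀)) := by rw [hm]; ring
        _ ≤ _ := by gcongr
    have h2 : ‖(t - ζ ^ 3) * S s‖ ≤ m := by
      rw [norm_mul]
      exact le_trans (by gcongr; exact hM s hs2) h
    have h4 : m ≤ ‖s * C s - t * S s‖ := by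
      rw [e]
      have := norm_sub_norm_le (ζ ^ 2 * Complex.exp (-(A * ζ))) ((t - ζ ^ 3) * S s)
      linarith
    have := pow_le_pow_left₀ hm0.le h4 2
    nlinarith [sq_nonneg ‖((m / (m / M) ^ 2 : ℝ) : ℂ) * (s ^ 3 - t ^ 2)‖]
  · have h1 : m / M ≤ ‖t - ζ ^ 3‖ := by rwa [div_le_iff₀ hM0]
    have h2 : (m / M) ^ 2 ≤ ‖s ^ 3 - t ^ 2‖ := by
      have e : s ^ 3 - t ^ 2 = -((t - ζ ^ 3) * (t + ζ ^ 3)) := by rw [← hζ]; ring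
      rw [e, norm_neg, norm_mul, sq]
      exact mul_le_mul h1 (h1.trans hle) (by positivity) (norm_nonneg _)
    have h3 : m ≤ ‖((m / (m / M) ^ 2 : ℝ) : ℂ) * (s ^ 3 - t ^ 2)‖ := by
      rw [norm_mul, Complex.norm_real, Real.norm_of_nonneg (by positivity)]
      calc m = m / (m / M) ^ 2 * (m / M) ^ 2 := by field_simp
        _ ≤ _ := by gcongr
    have := pow_le_pow_left₀ hm0.le h3 2
    nlinarith [sq_nonneg ‖s * C s - t * S s‖]

/-- A smooth plurisubharmonic function on `ℂ²`, vanishing near the origin, which on the cusp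
`(ζ², ζ³)` is dominated by `3 - a Re ζ`. -/
theorem exists_psh_on_cusp {a : ℝ} (ha : 0 < a) :
    ∃ H : Cn 2 → ℝ, ContDiff ℝ ∞ H ∧ (∀ p v, 0 ≤ leviForm H p v) ∧ H =ᶠ[𝓝 0] 0 ∧
      ∀ ζ : ℂ, ‖ζ‖ < 1 → H !₂[ζ ^ 2, ζ ^ 3] ≤ 3 - a * ζ.re := by
  set z₀ : ℝ := 1 / (8 * (a + 1)) with hz₀d
  have hz₀ : 0 < z₀ := by positivity
  have haz : a * z₀ ≤ 1 / 8 := by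
    rw [hz₀d, mul_one_div, div_le_iff₀ (by positivity)]; linarith
  have hz₁ : z₀ < 1 := by
    rw [hz₀d, div_lt_one (by positivity)]; linarith
  have hlog : 0 < Real.log (4 / z₀ ^ 2) := by
    apply Real.log_pos
    rw [one_lt_div (by positivity)]
    nlinarith
  -- This makes `K log (z₀²/4) = -1/2`. With `a z₀ ≤ 1/8` it yields `U ≥ 2 - 1/2 - 1/8 > 1` on the
  -- gluing shell, where the ramp is affine.
  set K : ℝ := 1 / (2 * Real.log (4 / z₀ ^ 2)) with hK
  have hK0 : 0 < K := by positivity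
  set A := a / K with hA
  have hKA : K * A = a := by rw [hA]; field_simp
  obtain ⟨C, S, hC, hS, hCS⟩ := exists_entire_exp_neg_eq A
  obtain ⟨N, hN, hlow⟩ := exists_cusp_lower_bound hS.continuous (A := A) (by positivity) hz₀ hCS
  set f : Cn 2 → ℂ := fun z => z 0 * C (z 0) - z 1 * S (z 0) with hf
  set g : Cn 2 → ℂ := fun z => (N : ℂ) * (z 0 ^ 3 - z 1 ^ 2) with hg
  have hcoord : ∀ i, ContDiff ℂ ∞ fun z : Cn 2 => z i := fun i => by fun_prop
  have hfC : ContDiff ℂ ∞ f :=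
    ((hcoord 0).mul (hC.contDiff.comp (hcoord 0))).sub
      ((hcoord 1).mul (hS.contDiff.comp (hcoord 0)))
  have hgC : ContDiff ℂ ∞ g := contDiff_const.mul (((hcoord 0).pow 3).sub ((hcoord 1).pow 2))
  set X : Cn 2 → ℝ := fun z => ‖f z‖ ^ 2 + ‖g z‖ ^ 2 with hX
  have hX0 : ∀ z, 0 ≤ X z := fun z => by positivity
  have hXc : Continuous X := (contDiff_normSq_add hfC hgC).continuous
  set U := logNormSq f g K 2 with hU
  have hUX : ∀ z, U z = K / 2 * Real.log (X z) + 2 := fun z => rfl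
  have hf_cusp : ∀ ζ : ℂ, f !₂[ζ ^ 2, ζ ^ 3] = ζ ^ 2 * Complex.exp (-(A * ζ)) := by
    intro ζ
    simp only [hf, ← hCS]
    simp
    ring
  have hg_cusp : ∀ ζ : ℂ, g !₂[ζ ^ 2, ζ ^ 3] = 0 := by
    intro ζ
    simp [hg]
    right; ring
  have hXpos : ∀ z : Cn 2, z 0 ≠ 0 → 0 < X z := by
    intro z hz
    refine lt_of_le_of_ne (hX0 z) fun h => ?_
    have hs : ‖f z‖ ^ 2 + ‖g z‖ ^ 2 = 0 := h.symm
    have h1 : ‖f z‖ ^ 2 = 0 := by linarith [sq_nonneg ‖f z‖, sq_nonneg ‖g z‖]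
    have h2 : ‖g z‖ ^ 2 = 0 := by linarith [sq_nonneg ‖f z‖, sq_nonneg ‖g z‖]
    have h3 : f z = 0 := by simpa using h1
    have h4 : z 0 ^ 3 = z 1 ^ 2 := by
      have : g z = 0 := by simpa using h2
      simpa [hg, hN.ne', sub_eq_zero] using this
    -- A point of `s³ = t²` with `s ≠ 0` has cusp parameter `t/s`, and `f` vanishes on the cusp only
    -- at `ζ = 0`.
    have hz' : z = !₂[(z 1 / z 0) ^ 2, (z 1 / z 0) ^ 3] := by
      ext i
      fin_cases i
      · simp only [div_pow, ← h4]; simp; field_simp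
      · have h5 : z 1 ^ 3 = z 0 ^ 3 * z 1 := by rw [h4]; ring
        simp only [div_pow, h5]; simp; field_simp
    have hne : z 1 / z 0 ≠ 0 := by
      refine div_ne_zero (fun h => ?_) hz
      rw [h] at h4
      exact hz (by simpa using h4)
    rw [hz', hf_cusp] at h3
    simp only [mul_eq_zero, Complex.exp_ne_zero, or_false] at h3
    exact pow_ne_zero 2 hne h3
  have hU1 : ∀ z : Cn 2, z₀ ^ 2 / 2 ≤ ‖z 0‖ → ‖z 0‖ ≤ z₀ ^ 2 → 1 ≤ U z := by
    intro z h1 h2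
    have h3 := Real.log_le_log (by positivity) (hlow (z 0) (z 1) h1 h2)
    rw [Real.log_pow, Real.log_mul (by positivity) (by positivity), Real.log_exp] at h3
    have h4 : K * Real.log (z₀ ^ 2 / 4) = -(1 / 2) := by
      rw [← inv_div, Real.log_inv, hK]; field_simp
    push_cast at h3
    have h5 := mul_le_mul_of_nonneg_left h3 (by positivity : 0 ≤ K / 2)
    have h6 : K / 2 * (2 * (Real.log (z₀ ^ 2 / 4) + -(A * z₀)))
      = K * Real.log (z₀ ^ 2 / 4) - (K * A) * z₀ := by ring
    rw [h6, h4, hKA] at h5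
    have : U z = K / 2 * Real.log (‖z 0 * C (z 0) - z 1 * S (z 0)‖ ^ 2 +
      ‖(N : ℂ) * (z 0 ^ 3 - z 1 ^ 2)‖ ^ 2) + 2 := rfl
    linarith
  have hUsmall : ∀ p, X p = 0 → ∀ᶠ z in 𝓝 p, X z = 0 ∨ U z ≤ 0 := by
    intro p hp
    have : ∀ᶠ z in 𝓝 p, X z < Real.exp (-(4 / K)) :=
      hXc.continuousAt.eventually_lt continuousAt_const (by rw [hp]; positivity)
    filter_upwards [this] with z hz
    rcases (hX0 z).eq_or_lt with h | h
    · exact Or.inl h.symm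
    · right
      have h1 := (Real.log_lt_log h hz).le
      rw [Real.log_exp] at h1
      have := mul_le_mul_of_nonneg_left h1 (by positivity : 0 ≤ K / 2)
      have e : K / 2 * (-(4 / K)) = -2 := by field_simp; norm_num
      rw [hUX]
      linarith
  -- The value `0` on `X = 0` must be imposed, since `Real.log 0 = 0` would give `U = 2` there.
  -- Outside, the ramp is dropped in favour of its affine part: `H` has to become negative where `a
  -- Re ζ > 3`.
  let H : Cn 2 → ℝ := fun z =>
    if ‖z 0‖ < z₀ ^ 2 then (if X z = 0 then 0 else smoothRamp (U z))
    else U z - (1 - smoothRamp 1)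
  have hcz : Continuous fun z : Cn 2 => ‖z 0‖ := by fun_prop
  have hinner : ∀ p, ‖p 0‖ < z₀ ^ 2 → X p = 0 → H =ᶠ[𝓝 p] 0 := by
    intro p h1 h2
    filter_upwards [hcz.continuousAt.eventually_lt continuousAt_const h1, hUsmall p h2] with z h3 h4
    simp only [H, if_pos h3, Pi.zero_apply]
    rcases h4 with h4 | h4
    · rw [if_pos h4]
    · split_ifs
      · rfl
      · exact smoothRamp.of_nonpos h4
  have hmid : ∀ p, ‖p 0‖ < z₀ ^ 2 → 0 < X p → H =ᶠ[𝓝 p] fun z => smoothRamp (U z) := by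
    intro p h1 h2
    filter_upwards [hcz.continuousAt.eventually_lt continuousAt_const h1,
      continuousAt_const.eventually_lt hXc.continuousAt h2] with z h3 h4
    simp only [H, if_pos h3, if_neg h4.ne']
  have houter : ∀ p, z₀ ^ 2 ≤ ‖p 0‖ → H =ᶠ[𝓝 p] logNormSq f g K (2 - (1 - smoothRamp 1)) := by
    intro p h1
    have h2 : z₀ ^ 2 / 2 < ‖p 0‖ := by nlinarith [pow_pos hz₀ 2]
    filter_upwards [continuousAt_const.eventually_lt hcz.continuousAt h2] with z h3
    have e : logNormSq f g K (2 - (1 - smoothRamp 1)) z = U z - (1 - smoothRamp 1) := by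
      simp only [hU, logNormSq]; ring
    rw [e]
    simp only [H]
    split_ifs with h4 h5
    · have : z 0 ≠ 0 := by
        rw [← norm_pos_iff]; exact lt_trans (by positivity) h3
      exact absurd h5 (hXpos z this).ne'
    · exact smoothRamp.of_one_le (hU1 z h3.le h4.le)
    · rfl
  have hout_pos : ∀ p : Cn 2, z₀ ^ 2 ≤ ‖p 0‖ → 0 < X p := fun p hp =>
    hXpos p (norm_pos_iff.1 (lt_of_lt_of_le (by positivity) hp))
  refine ⟨H, contDiff_iff_contDiffAt.2 fun p => ?_, fun p v => ?_, ?_, ?_⟩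
  · rcases lt_or_ge ‖p 0‖ (z₀ ^ 2) with h1 | h1
    · rcases (hX0 p).eq_or_lt with h2 | h2
      · exact contDiffAt_const.congr_of_eventuallyEq (hinner p h1 h2.symm)
      · exact (contDiffAt_smoothRamp_logNormSq hfC hgC K 2 h2).congr_of_eventuallyEq (hmid p h1 h2)
    · exact (contDiffAt_logNormSq hfC hgC K _ (hout_pos p h1)).congr_of_eventuallyEq (houter p h1)
  · rcases lt_or_ge ‖p 0‖ (z₀ ^ 2) with h1 | h1
    · rcases (hX0 p).eq_or_lt with h2 | h2
      · rw [leviForm_congr (hinner p h1 h2.symm)]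
        simp [leviForm]
      · rw [leviForm_congr (hmid p h1 h2)]
        exact leviForm_smoothRamp_logNormSq_nonneg hfC hgC hK0.le 2 h2 v
    · rw [leviForm_congr (houter p h1)]
      exact leviForm_logNormSq_nonneg hfC hgC hK0.le _ (hout_pos p h1) v
  · exact hinner 0 (by simp; positivity) (by simp [hX, hf, hg])
  · intro ζ hζ
    rcases eq_or_ne ζ 0 with rfl | hne
    · have : H !₂[(0 : ℂ) ^ 2, 0 ^ 3] = 0 :=
        (hinner !₂[(0 : ℂ) ^ 2, 0 ^ 3] (by simp; positivity) (by simp [hX, hf, hg])).eq_of_nhds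
      rw [this]
      simp
    have hn : 0 < ‖ζ‖ := norm_pos_iff.2 hne
    have hXζ : X !₂[ζ ^ 2, ζ ^ 3] = (‖ζ‖ ^ 2 * Real.exp (-(A * ζ.re))) ^ 2 := by
      simp only [hX, hf_cusp, hg_cusp]
      simp [Complex.norm_exp]
    have hUζ : U !₂[ζ ^ 2, ζ ^ 3] ≤ 2 - a * ζ.re := by
      rw [hUX, hXζ, Real.log_pow, Real.log_mul (by positivity) (by positivity), Real.log_pow,
        Real.log_exp]
      -- In the unit disc the term `2K log |ζ|` is nonpositive and can be discarded.
      have h1 := Real.log_nonpos hn.le hζ.le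
      have h2 : K / 2 * ((2 : ℕ) * ((2 : ℕ) * Real.log ‖ζ‖ + -(A * ζ.re)))
        = 2 * (K * Real.log ‖ζ‖) - (K * A) * ζ.re := by push_cast; ring
      rw [h2, hKA]
      nlinarith
    have hXne : X !₂[ζ ^ 2, ζ ^ 3] ≠ 0 := by rw [hXζ]; positivity
    simp only [H]
    rw [if_neg hXne]
    split_ifs with h1
    · refine (smoothRamp.le_max _).trans (max_le (by linarith) ?_)
      have h2 : ‖ζ‖ ≤ z₀ := by
        have : ‖ζ‖ ^ 2 < z₀ ^ 2 := by simpa using h1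
        exact (lt_of_pow_lt_pow_left₀ 2 hz₀.le this).le
      have := mul_le_mul_of_nonneg_left ((Complex.re_le_norm ζ).trans h2) ha.le
      linarith
    · have := smoothRamp.one_le_one
      linarith

/-- A rescaled version of `exists_psh_on_cusp`, for a cusp in a small ball. -/
theorem exists_psh_on_small_cusp {a η : ℝ} (ha : 0 < a) (hη : 0 < η) :
    ∃ (H : Cn 2 → ℝ) (c e : ℝ), 0 < e ∧ ContDiff ℝ ∞ H ∧ (∀ p v, 0 ≤ leviForm H p v) ∧
      (∀ z, ‖z‖ < e → H z = 0) ∧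
      ∀ ζ : ℂ, ‖ζ‖ < 1 → ‖(!₂[(c : ℂ) ^ 2 * ζ ^ 2, (c : ℂ) ^ 3 * ζ ^ 3] : Cn 2)‖ < η ∧
        H !₂[(c : ℂ) ^ 2 * ζ ^ 2, (c : ℂ) ^ 3 * ζ ^ 3] ≤ 3 - a * ζ.re := by
  obtain ⟨H, hH, hL, h0, hb⟩ := exists_psh_on_cusp ha
  set c : ℝ := min 1 (η / 2) with hc
  have hc0 : 0 < c := by positivity
  have hc1 : c ≤ 1 := min_le_left _ _
  have hcη : c ≤ η / 2 := min_le_right _ _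
  have hcC : (c : ℂ) ≠ 0 := by exact_mod_cast hc0.ne'
  -- The weighted dilation carrying the small cusp to the unit cusp; being complex linear, it
  -- preserves nonnegative Levi forms.
  let T : Cn 2 →L[ℂ] Cn 2 := LinearMap.toContinuousLinearMap
    { toFun := fun z => !₂[z 0 / (c : ℂ) ^ 2, z 1 / (c : ℂ) ^ 3]
      map_add' := fun x y => by ext i; fin_cases i <;> simp [add_div]
      map_smul' := fun k x => by ext i; fin_cases i <;> simp [mul_div_assoc] }
  have hT : ∀ z, T z = !₂[z 0 / (c : ℂ) ^ 2, z 1 / (c : ℂ) ^ 3] := fun z => rfl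
  have hev : ∀ᶠ z in 𝓝 (0 : Cn 2), H (T z) = 0 :=
    (T.continuous.tendsto' 0 0 (map_zero T)).eventually h0
  obtain ⟨e, he, hball⟩ := Metric.eventually_nhds_iff.1 hev
  refine ⟨fun z => H (T z), c, e, he, hH.comp (T.contDiff.restrict_scalars ℝ), fun p v => ?_,
    fun z hz => hball (by simpa using hz), fun ζ hζ => ⟨?_, ?_⟩⟩
  · rw [leviForm_comp_clm T ((contDiff_infty.1 hH 2).contDiffAt)]
    exact hL _ _
  · have h2 : ‖(c : ℂ) ^ 2 * ζ ^ 2‖ ≤ c := by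
      simp only [norm_mul, norm_pow, Complex.norm_real, Real.norm_of_nonneg hc0.le]
      calc c ^ 2 * ‖ζ‖ ^ 2 ≤ c ^ 2 * 1 := by gcongr; exact pow_le_one₀ (norm_nonneg _) hζ.le
        _ ≤ c := by nlinarith
    have h3 : ‖(c : ℂ) ^ 3 * ζ ^ 3‖ ≤ c := by
      simp only [norm_mul, norm_pow, Complex.norm_real, Real.norm_of_nonneg hc0.le]
      calc c ^ 3 * ‖ζ‖ ^ 3 ≤ c ^ 3 * 1 := by gcongr; exact pow_le_one₀ (norm_nonneg _) hζ.le
        _ ≤ c := by rw [mul_one]; exact pow_le_of_le_one hc0.le hc1 (by norm_num)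
    refine lt_of_pow_lt_pow_left₀ 2 hη.le ?_
    rw [EuclideanSpace.norm_sq_eq, Fin.sum_univ_two]
    have h2' := pow_le_pow_left₀ (norm_nonneg _) h2 2
    have h3' := pow_le_pow_left₀ (norm_nonneg _) h3 2
    have h4 := pow_le_pow_left₀ hc0.le hcη 2
    calc _ ≤ c ^ 2 + c ^ 2 := add_le_add h2' h3'
      _ < η ^ 2 := by nlinarith [pow_pos hη 2]
  · have e1 : T !₂[(c : ℂ) ^ 2 * ζ ^ 2, (c : ℂ) ^ 3 * ζ ^ 3] = !₂[ζ ^ 2, ζ ^ 3] := by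
      rw [hT]
      ext i
      fin_cases i <;> simp <;> field_simp
    simp only [e1]
    exact hb ζ hζ

/-! ### Series with geometrically small derivatives -/

section Series

variable {E : Type*} [NormedAddCommGroup E] [NormedSpace ℝ E]

/-- Compact support bounds each of the finitely many derivatives. The estimate covers all smaller
coefficients because it is applied both to `β n` and to the smaller product `δ n`. -/
theorem exists_coeff_iteratedFDeriv_le {g : E → ℝ} (hg : ContDiff ℝ ∞ g)
    (hc : HasCompactSupport g) (n : ℕ) {ε : ℝ} (hε : 0 < ε) :
    ∃ b > 0, ∀ d : ℝ, 0 ≤ d → d ≤ b → ∀ k ≤ n, ∀ x,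
      ‖iteratedFDeriv ℝ k (fun y => d * g y) x‖ ≤ ε := by
  have hM : ∀ k : ℕ, ∃ M, ∀ x, ‖iteratedFDeriv ℝ k g x‖ ≤ M := fun k =>
    (hc.iteratedFDeriv k).exists_bound_of_continuous
      (hg.continuous_iteratedFDeriv (WithTop.coe_le_coe.2 (le_top (a := (k : ℕ∞)))))
  choose M hM using hM
  have hM0 : ∀ k, 0 ≤ M k := fun k => (norm_nonneg _).trans (hM k 0)
  set S := ∑ k ∈ Finset.range (n + 1), M k
  have hS : 0 ≤ S := Finset.sum_nonneg fun k _ => hM0 k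
  refine ⟨ε / (S + 1), by positivity, fun d hd0 hd k hk x => ?_⟩
  have e : iteratedFDeriv ℝ k (fun y => d * g y) x = d • iteratedFDeriv ℝ k g x :=
    iteratedFDeriv_const_smul_apply (a := d)
      ((contDiff_infty.1 hg k).contDiffAt)
  rw [e, norm_smul, Real.norm_of_nonneg hd0]
  have h1 : M k ≤ S := Finset.single_le_sum (fun k _ => hM0 k) (Finset.mem_range.2 (by omega))
  calc d * ‖iteratedFDeriv ℝ k g x‖ ≤ ε / (S + 1) * (S + 1) := by
        gcongr
        linarith [hM k x]
    _ = ε := by field_simp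

variable {h : ℕ → E → ℝ} {ε : ℝ}

theorem summable_geometric_const (ε : ℝ) : Summable fun n : ℕ => ε * (1 / 2 : ℝ) ^ n :=
  summable_geometric_two.mul_left ε

/-- For fixed `k` all but finitely many terms obey the bound, which suffices for smoothness. The
offset `2` puts orders up to two under control for every `n`, as needed for the Lipschitz bound and
the Levi form of the sum. -/
theorem contDiff_tsum_of_le_geometric (hh : ∀ n, ContDiff ℝ ∞ (h n))
    (hb : ∀ n, ∀ k ≤ n + 2, ∀ x, ‖iteratedFDeriv ℝ k (h n) x‖ ≤ ε * (1 / 2) ^ n) :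
    ContDiff ℝ ∞ fun x => ∑' n, h n x := by
  refine contDiff_tsum_of_eventually (v := fun _ n => ε * (1 / 2) ^ n) hh
    (fun _ _ => summable_geometric_const ε) fun k _ => ?_
  rw [Nat.cofinite_eq_atTop]
  filter_upwards [eventually_ge_atTop k] with n hn x
  exact hb n k (by omega) x

theorem iteratedFDeriv_two_tsum_of_le_geometric (hh : ∀ n, ContDiff ℝ ∞ (h n))
    (hb : ∀ n, ∀ k ≤ n + 2, ∀ x, ‖iteratedFDeriv ℝ k (h n) x‖ ≤ ε * (1 / 2) ^ n) (x : E) :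
    HasSum (fun n => iteratedFDeriv ℝ 2 (h n) x)
      (iteratedFDeriv ℝ 2 (fun x => ∑' n, h n x) x) := by
  rw [iteratedFDeriv_tsum_apply (N := (2 : ℕ∞)) (v := fun _ n => ε * (1 / 2) ^ n)
    (fun n => contDiff_infty.1 (hh n) 2) (fun _ _ => summable_geometric_const ε)
    (fun k n x hk => hb n k (by have : k ≤ 2 := by exact_mod_cast hk
                                omega) x) le_rfl]
  exact (Summable.of_norm_bounded (summable_geometric_const ε) fun n => hb n 2 (by omega) x).hasSum

theorem abs_tsum_sub_le_of_le_geometric (hh : ∀ n, ContDiff ℝ ∞ (h n))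
    (hb : ∀ n, ∀ k ≤ n + 2, ∀ x, ‖iteratedFDeriv ℝ k (h n) x‖ ≤ ε * (1 / 2) ^ n) (x y : E) :
    |∑' n, h n x - ∑' n, h n y| ≤ 2 * ε * ‖x - y‖ := by
  have hs : ∀ x, Summable fun n => h n x := fun x =>
    Summable.of_norm_bounded (summable_geometric_const ε) fun n => by
      simpa using hb n 0 (by omega) x
  rw [← (hs x).tsum_sub (hs y)]
  have hterm : ∀ n, ‖h n x - h n y‖ ≤ ε * ‖x - y‖ * (1 / 2) ^ n := by
    intro n
    have := (convex_univ (𝕜 := ℝ) (E := E)).norm_image_sub_le_of_norm_fderiv_le (f := h n)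
      (C := ε * (1 / 2) ^ n) (fun z _ => (hh n).differentiable (by simp) z)
      (fun z _ => by simpa [norm_iteratedFDeriv_one] using hb n 1 (by omega) z)
      (mem_univ y) (mem_univ x)
    linarith
  have := tsum_of_norm_bounded ((hasSum_geometric_two).mul_left (ε * ‖x - y‖)) hterm
  rw [Real.norm_eq_abs] at this
  linarith

end Series

theorem leviForm_const_mul {n : ℕ} {f : Cn n → ℝ} {p : Cn n} (hf : ContDiffAt ℝ 2 f p) (c : ℝ)
    (v : Cn n) : leviForm (fun x => c * f x) p v = c * leviForm f p v := by
  have e : iteratedFDeriv ℝ 2 (fun y => c * f y) p = c • iteratedFDeriv ℝ 2 f p :=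
    iteratedFDeriv_const_smul_apply (a := c) hf
  simp only [leviForm_eq_iteratedFDeriv, e, smul_apply, smul_eq_mul]
  ring

theorem leviForm_nonneg_of_hasSum {n : ℕ} {f : Cn n → ℝ} {h : ℕ → Cn n → ℝ} {p : Cn n}
    (hs : HasSum (fun k => iteratedFDeriv ℝ 2 (h k) p) (iteratedFDeriv ℝ 2 f p)) {v : Cn n}
    (hnn : ∀ k, 0 ≤ leviForm (h k) p v) : 0 ≤ leviForm f p v := by
  have hap : ∀ m : Fin 2 → Cn n, HasSum (fun k => iteratedFDeriv ℝ 2 (h k) p m)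
      (iteratedFDeriv ℝ 2 f p m) := fun m =>
    (ContinuousMultilinearMap.apply ℝ (fun _ : Fin 2 => Cn n) ℝ m).hasSum hs
  have := ((hap ![v, v]).add (hap ![Complex.I • v, Complex.I • v])).div_const 4
  rw [leviForm_eq_iteratedFDeriv]
  exact this.nonneg fun k => by simpa only [leviForm_eq_iteratedFDeriv] using hnn k

/-! ### Superposition over a sequence of shrinking cusps -/

/-- The sequence `η₀ = η`, `ηₙ₊₁ = min ηₙ (e n ηₙ)`. -/
noncomputable def shrinkingRadii (e : ℕ → ℝ → ℝ) (η : ℝ) : ℕ → ℝ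
  | 0 => η
  | n + 1 => min (shrinkingRadii e η n) (e n (shrinkingRadii e η n))

theorem antitone_shrinkingRadii (e : ℕ → ℝ → ℝ) (η : ℝ) : Antitone (shrinkingRadii e η) :=
  antitone_nat_of_succ_le fun _ => min_le_left _ _

theorem shrinkingRadii_le_of_lt (e : ℕ → ℝ → ℝ) (η : ℝ) {m n : ℕ} (h : m < n) :
    shrinkingRadii e η n ≤ e m (shrinkingRadii e η m) :=
  (antitone_shrinkingRadii e η (Nat.succ_le_of_lt h)).trans (min_le_right _ _)

theorem shrinkingRadii_pos {e : ℕ → ℝ → ℝ} {η : ℝ} (hη : 0 < η)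
    (he : ∀ n η, 0 < η → 0 < e n η) : ∀ n, 0 < shrinkingRadii e η n
  | 0 => hη
  | n + 1 => lt_min (shrinkingRadii_pos hη he n) (he n _ (shrinkingRadii_pos hη he n))

/-- A sequence of functions as in `exists_psh_on_small_cusp`, each vanishing on the cusps of the
later ones. -/
theorem exists_seq_psh_on_cusps {a : ℕ → ℝ} (ha : ∀ n, 0 < a n) {η₀ : ℝ} (hη₀ : 0 < η₀) :
    ∃ (H : ℕ → Cn 2 → ℝ) (c η : ℕ → ℝ), (∀ n, 0 < η n) ∧ (∀ n, η n ≤ η₀) ∧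
      (∀ n, ContDiff ℝ ∞ (H n)) ∧ (∀ n p v, 0 ≤ leviForm (H n) p v) ∧
      (∀ m n, m < n → ∀ z, ‖z‖ < η n → H m z = 0) ∧
      ∀ (n : ℕ) (ζ : ℂ), ‖ζ‖ < 1 →
        ‖(!₂[(c n : ℂ) ^ 2 * ζ ^ 2, (c n : ℂ) ^ 3 * ζ ^ 3] : Cn 2)‖ < η n ∧
        H n !₂[(c n : ℂ) ^ 2 * ζ ^ 2, (c n : ℂ) ^ 3 * ζ ^ 3] ≤ 3 - a n * ζ.re := by
  -- Positivity of `η` is moved into the conclusion so that `choose` yields a total function `e`,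
  -- usable in the recursion for the radii.
  have key : ∀ (n : ℕ) (η : ℝ), ∃ (H : Cn 2 → ℝ) (c e : ℝ), 0 < η → 0 < e ∧ ContDiff ℝ ∞ H ∧
      (∀ p v, 0 ≤ leviForm H p v) ∧ (∀ z, ‖z‖ < e → H z = 0) ∧
      ∀ ζ : ℂ, ‖ζ‖ < 1 → ‖(!₂[(c : ℂ) ^ 2 * ζ ^ 2, (c : ℂ) ^ 3 * ζ ^ 3] : Cn 2)‖ < η ∧
        H !₂[(c : ℂ) ^ 2 * ζ ^ 2, (c : ℂ) ^ 3 * ζ ^ 3] ≤ 3 - a n * ζ.re := by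
    intro n η
    by_cases hη : 0 < η
    · obtain ⟨H, c, e, h⟩ := exists_psh_on_small_cusp (ha n) hη
      exact ⟨H, c, e, fun _ => h⟩
    · exact ⟨0, 0, 0, fun h => absurd h hη⟩
  choose H c e h using key
  set η := shrinkingRadii e η₀
  have hη : ∀ n, 0 < η n := shrinkingRadii_pos hη₀ fun n η hη => (h n η hη).1
  refine ⟨fun n => H n (η n), fun n => c n (η n), η, hη,
    fun n => antitone_shrinkingRadii e η₀ (Nat.zero_le n),
    fun n => (h n _ (hη n)).2.1, fun n => (h n _ (hη n)).2.2.1, fun m n hmn z hz => ?_,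
    fun n => (h n _ (hη n)).2.2.2.2⟩
  exact (h m _ (hη m)).2.2.2.1 z (hz.trans_le (shrinkingRadii_le_of_lt e η₀ hmn))

theorem tsum_le_of_le_single_add {f : ℕ → ℝ} (hf : Summable f) {n : ℕ} {A B : ℝ}
    (h : ∀ m, f m ≤ (if m = n then A else 0) + B * (1 / 2) ^ m) : ∑' m, f m ≤ A + 2 * B := by
  have h1 : HasSum (fun m => (if m = n then A else 0) + B * (1 / 2 : ℝ) ^ m) (A + B * 2) :=
    (hasSum_ite_eq n A).add (hasSum_geometric_two.mul_left B)
  have := hasSum_le h hf.hasSum h1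
  linarith

/-- A smooth function on `ℂ²`, plurisubharmonic near the origin and flat there, with small
derivative, which on a sequence of cusps is below `δ (1 - a Re ζ)`. -/
theorem exists_flat_psh_on_cusps {a : ℕ → ℝ} (ha : ∀ n, 0 < a n) {ε : ℝ} (hε : 0 < ε) :
    ∃ (ρ : Cn 2 → ℝ) (δ c : ℕ → ℝ), ContDiff ℝ ∞ ρ ∧
      (∀ p ∈ ball (0 : Cn 2) 4, ∀ v, 0 ≤ leviForm ρ p v) ∧
      (∀ x y, |ρ x - ρ y| ≤ ε * ‖x - y‖) ∧
      (∀ k : ℕ, ∃ s > 0, ∀ z : Cn 2, ‖z‖ < s → |ρ z| ≤ 2 * ‖z‖ ^ k) ∧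
      (∀ n, 0 < δ n) ∧ StrictAnti δ ∧ Tendsto δ atTop (𝓝 0) ∧
      (∀ n, δ n ≤ 1 / 4) ∧ (∀ n, a n * δ n ≤ 1 / 4) ∧
      ∀ (n : ℕ) (ζ : ℂ), ‖ζ‖ < 1 →
        ‖(!₂[(c n : ℂ) ^ 2 * ζ ^ 2, (c n : ℂ) ^ 3 * ζ ^ 3] : Cn 2)‖ < 1 / 2 ∧
        ρ !₂[(c n : ℂ) ^ 2 * ζ ^ 2, (c n : ℂ) ^ 3 * ζ ^ 3] < δ n * (1 - a n * ζ.re) := by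
  obtain ⟨H, c, η, hη, hη₀, hHs, hHL, hH0, hHb⟩ :=
    -- Slope `4 aₙ` and the later factor `1/4` turn `3 - 4 aₙ Re ζ` into `3/4 - aₙ Re ζ`, leaving
    -- room `1/4` for the other terms.
    exists_seq_psh_on_cusps (a := fun n => 4 * a n) (fun n => mul_pos four_pos (ha n))
      (η₀ := 1 / 2) (by norm_num)
  let θ : ContDiffBump (0 : Cn 2) := ⟨4, 5, by norm_num, by norm_num⟩
  have hθ1 : ∀ z : Cn 2, ‖z‖ ≤ 4 → θ z = 1 := fun z hz => θ.one_of_mem_closedBall (by simpa using hz)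
  set g : ℕ → Cn 2 → ℝ := fun n z => θ z * (1 / 4 * H n z) with hg
  have hgs : ∀ n, ContDiff ℝ ∞ (g n) := fun n => θ.contDiff.mul (contDiff_const.mul (hHs n))
  have hgc : ∀ n, HasCompactSupport (g n) := fun n => θ.hasCompactSupport.mul_right
  have hg0 : ∀ m n, m < n → ∀ z, ‖z‖ < η n → g m z = 0 := fun m n hmn z hz => by
    simp [hg, hH0 m n hmn z hz]
  -- The three caps serve the Lipschitz bound, the error on earlier cusps, and flatness at the
  -- origin.
  set κ : ℕ → ℝ := fun n => min (ε / 2) (min (1 / 16) (η (n + 1) ^ n))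
  have hκ : ∀ n, 0 < κ n := fun n =>
    lt_min (by positivity) (lt_min (by norm_num) (pow_pos (hη _) _))
  choose b hb0 hb using fun n =>
    exists_coeff_iteratedFDeriv_le (hgs n) (hgc n) (n + 2)
      (mul_pos (hκ n) (pow_pos one_half_pos n))
  set β : ℕ → ℝ := fun n => min (b n) (min (1 / 4) (1 / (4 * a n)))
  have hβ0 : ∀ n, 0 < β n := fun n =>
    lt_min (hb0 n) (lt_min (by norm_num) (by have := ha n; positivity))
  have hβb : ∀ n, β n ≤ b n := fun n => min_le_left _ _
  have hβ4 : ∀ n, β n ≤ 1 / 4 := fun n => (min_le_right _ _).trans (min_le_left _ _)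
  have hβa : ∀ n, a n * β n ≤ 1 / 4 := fun n => by
    have h1 : β n ≤ 1 / (4 * a n) := (min_le_right _ _).trans (min_le_right _ _)
    have h2 := ha n
    calc a n * β n ≤ a n * (1 / (4 * a n)) := by gcongr
      _ = 1 / 4 := by field_simp
  -- With a product, every later coefficient is `δ j * β (j + 1)` with `δ j ≤ δ n`, so its error on
  -- the `n`-th cusp is small relative to `δ n`.
  set δ : ℕ → ℝ := fun n => ∏ i ∈ Finset.range (n + 1), β i
  have hδ0 : ∀ n, 0 < δ n := fun n => Finset.prod_pos fun i _ => hβ0 i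
  have hδs : ∀ n, δ (n + 1) = δ n * β (n + 1) := fun n => Finset.prod_range_succ _ _
  have hδz : δ 0 = β 0 := by simp [δ]
  have hδq : ∀ n, δ n ≤ (1 / 4) ^ (n + 1) := by
    intro n
    induction n with
    | zero => simpa [hδz] using hβ4 0
    | succ n ih =>
      rw [hδs, pow_succ]
      exact mul_le_mul ih (hβ4 _) (hβ0 _).le (by positivity)
  have hδ1 : ∀ n, δ n ≤ 1 := fun n => (hδq n).trans (pow_le_one₀ (by norm_num) (by norm_num))
  have hδβ : ∀ n, δ n ≤ β n := by
    rintro (_ | n)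
    · exact hδz.le
    · rw [hδs]
      exact mul_le_of_le_one_left (hβ0 _).le (hδ1 n)
  have hδanti : StrictAnti δ := strictAnti_nat_of_succ_lt fun n => by
    rw [hδs]
    have := hδ0 n
    nlinarith [hβ4 (n + 1)]
  set h : ℕ → Cn 2 → ℝ := fun n z => δ n * g n z
  have hhs : ∀ n, ContDiff ℝ ∞ (h n) := fun n => contDiff_const.mul (hgs n)
  have hhκ : ∀ n, ∀ k ≤ n + 2, ∀ x, ‖iteratedFDeriv ℝ k (h n) x‖ ≤ κ n * (1 / 2) ^ n :=
    fun n => hb n (δ n) (hδ0 n).le ((hδβ n).trans (hβb n))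
  have hhε : ∀ n, ∀ k ≤ n + 2, ∀ x, ‖iteratedFDeriv ℝ k (h n) x‖ ≤ ε / 2 * (1 / 2) ^ n :=
    fun n k hk x => (hhκ n k hk x).trans (by gcongr; exact min_le_left _ _)
  have hhabs : ∀ n z, |h n z| ≤ κ n * (1 / 2) ^ n := fun n z => by
    simpa using hhκ n 0 (by omega) z
  have hsum : ∀ z, Summable fun n => h n z := fun z =>
    Summable.of_norm_bounded (summable_geometric_const (ε / 2)) fun n => by
      simpa using hhε n 0 (by omega) z
  refine ⟨fun z => ∑' n, h n z, δ, c, contDiff_tsum_of_le_geometric hhs hhε, ?_, ?_, ?_, hδ0,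
    hδanti, ?_, ?_, ?_, ?_⟩
  · intro p hp v
    refine leviForm_nonneg_of_hasSum (iteratedFDeriv_two_tsum_of_le_geometric hhs hhε p) fun n => ?_
    have hev : h n =ᶠ[𝓝 p] fun z => δ n * (1 / 4) * H n z := by
      filter_upwards [isOpen_ball.mem_nhds hp] with z hz
      simp only [h, hg, hθ1 z (by simpa using (mem_ball_zero_iff.1 hz).le)]
      ring
    rw [leviForm_congr hev, leviForm_const_mul (contDiff_infty.1 (hHs n) 2).contDiffAt]
    exact mul_nonneg (by have := hδ0 n; positivity) (hHL n p v)
  · intro x y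
    have := abs_tsum_sub_le_of_le_geometric hhs hhε x y
    linarith
  · intro k
    refine ⟨min 1 (η k), lt_min one_pos (hη k), fun z hz => ?_⟩
    have hz1 : ‖z‖ ≤ 1 := (hz.trans_le (min_le_left _ _)).le
    have hz2 : ‖z‖ < η k := hz.trans_le (min_le_right _ _)
    have hterm : ∀ n, ‖h n z‖ ≤ ‖z‖ ^ k * (1 / 2) ^ n := by
      intro n
      rw [Real.norm_eq_abs]
      rcases lt_or_ge n k with hnk | hnk
      · simp only [h, hg0 n k hnk z hz2, mul_zero, abs_zero]
        positivity
      -- The `n`-th term vanishes inside radius `η (n + 1)`; outside, its cap `η (n + 1) ^ n` is at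
      -- most `‖z‖ ^ n`.
      · rcases lt_or_ge ‖z‖ (η (n + 1)) with h1 | h1
        · simp only [h, hg0 n (n + 1) (by omega) z h1, mul_zero, abs_zero]
          positivity
        · refine (hhabs n z).trans ?_
          gcongr
          calc κ n ≤ η (n + 1) ^ n := (min_le_right _ _).trans (min_le_right _ _)
            _ ≤ ‖z‖ ^ n := pow_le_pow_left₀ (hη _).le h1 n
            _ ≤ ‖z‖ ^ k := pow_le_pow_of_le_one (norm_nonneg _) hz1 hnk
    have := tsum_of_norm_bounded (hasSum_geometric_two.mul_left (‖z‖ ^ k)) hterm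
    rw [Real.norm_eq_abs] at this
    linarith
  · refine squeeze_zero (fun n => (hδ0 n).le) hδq ?_
    exact (tendsto_pow_atTop_nhds_zero_of_lt_one (by norm_num) (by norm_num)).comp
      (tendsto_add_atTop_nat 1)
  · exact fun n => (hδβ n).trans (hβ4 n)
  · exact fun n => (mul_le_mul_of_nonneg_left (hδβ n) (ha n).le).trans (hβa n)
  · intro n ζ hζ
    obtain ⟨h1, h2⟩ := hHb n ζ hζ
    set z : Cn 2 := !₂[(c n : ℂ) ^ 2 * ζ ^ 2, (c n : ℂ) ^ 3 * ζ ^ 3] with hz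
    have hz2 : ‖z‖ < 1 / 2 := h1.trans_le (hη₀ n)
    refine ⟨hz2, ?_⟩
    -- Summing gives `δ n * (3/4 + 1/8 - a n Re ζ)`, strictly below the target.
    have hle : ∀ m, h m z ≤ (if m = n then δ n * (3 / 4 - a n * ζ.re) else 0)
        + δ n / 16 * (1 / 2) ^ m := by
      intro m
      rcases lt_trichotomy m n with hmn | rfl | hmn
      · simp only [h, hg0 m n hmn z h1, mul_zero, if_neg hmn.ne, zero_add]
        have := hδ0 n
        positivity
      · rw [if_pos rfl]
        have h3 : h m z ≤ δ m * (3 / 4 - a m * ζ.re) := by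
          simp only [h, hg, hθ1 z (by linarith), one_mul]
          exact mul_le_mul_of_nonneg_left (by linarith) (hδ0 m).le
        have := hδ0 m
        have : 0 ≤ δ m / 16 * (1 / 2) ^ m := by positivity
        linarith
      · rw [if_neg hmn.ne', zero_add]
        obtain ⟨j, rfl⟩ : ∃ j, m = j + 1 := ⟨m - 1, by omega⟩
        have h4 : |β (j + 1) * g (j + 1) z| ≤ κ (j + 1) * (1 / 2) ^ (j + 1) := by
          simpa using hb (j + 1) (β (j + 1)) (hβ0 _).le (hβb _) 0 (by omega) z
        have h5 : κ (j + 1) ≤ 1 / 16 := (min_le_right _ _).trans (min_le_left _ _)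
        have h6 : δ j ≤ δ n := hδanti.antitone (by omega)
        calc h (j + 1) z = δ j * (β (j + 1) * g (j + 1) z) := by simp only [h, hδs]; ring
          _ ≤ δ n * (1 / 16 * (1 / 2) ^ (j + 1)) := by
            refine mul_le_mul_of_nonneg_left (le_abs_self _) (hδ0 j).le |>.trans ?_
            refine mul_le_mul h6 (h4.trans ?_) (abs_nonneg _) (hδ0 n).le
            gcongr
          _ = _ := by ring
    have h7 := tsum_le_of_le_single_add (hsum z) hle
    have := hδ0 n
    show ∑' m, h m z < _
    nlinarith

/-! ### Small Lipschitz perturbations of convex functions -/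

section Perturbation

variable {E : Type*} [NormedAddCommGroup E] [NormedSpace ℝ E] {f g : E → ℝ} {ε R m : ℝ} {q : E}

/-- A sublevel set of a Lipschitz-small perturbation of a convex function is star-shaped about a
point where the function is sufficiently negative. -/
theorem starConvex_sublevel_of_convexOn_add (hf : ConvexOn ℝ univ f)
    (hg : ∀ x y, |g x - g y| ≤ ε * ‖x - y‖) (hε : 0 ≤ ε) (hgq : g q = 0) (hfq : f q = -m)
    (hR : ∀ x, f x + g x < 0 → ‖x - q‖ ≤ R) (hm : 2 * ε * R < m) :
    StarConvex ℝ q {x | f x + g x < 0} := by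
  intro x hx s t hs ht hst
  have hx' : f x + g x < 0 := hx
  have h1 : f (s • q + t • x) ≤ s * f q + t * f x :=
    hf.2 (mem_univ q) (mem_univ x) hs ht hst
  obtain rfl : s = 1 - t := by linarith
  have h2 : (1 - t) • q + t • x - x = (1 - t) • (q - x) := by module
  have h3 : (1 - t) • q + t • x - q = t • (x - q) := by module
  have h4 := (abs_le.1 (hg ((1 - t) • q + t • x) x)).2
  have h5 := (abs_le.1 (hg ((1 - t) • q + t • x) q)).2
  rw [h2, norm_smul, Real.norm_of_nonneg hs, norm_sub_rev] at h4
  rw [h3, norm_smul, Real.norm_of_nonneg ht] at h5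
  show f ((1 - t) • q + t • x) + g ((1 - t) • q + t • x) < 0
  -- If `f` rises enough from `q` to `x`, convexity absorbs the change of `g` measured from `x`.
  -- Otherwise `f` stays near `-m` on the segment, and the change of `g` is measured from `q`.
  rcases le_total (ε * ‖x - q‖) (f x - f q) with h | h
  · nlinarith [mul_le_mul_of_nonneg_left h hs]
  · have h6 := mul_le_mul_of_nonneg_left h ht
    have h7 : t * (ε * ‖x - q‖) ≤ ε * R := by
      have := mul_le_mul_of_nonneg_left (hR x hx') hε
      have h8 : 0 ≤ ε * ‖x - q‖ := by positivity
      nlinarith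
    nlinarith

/-- At a critical zero, the derivative of `f` towards `q` is at least `-εR` and `f x = -g x ≥ -εR`.
The tangent inequality would then give `-m = f q ≥ -2εR`. -/
theorem fderiv_ne_zero_of_convexOn_add (hf : ConvexOn ℝ univ f) (hε : 0 ≤ ε)
    (hg : ∀ x y, |g x - g y| ≤ ε * ‖x - y‖) (hgq : g q = 0) (hfq : f q = -m) (hm : 2 * ε * R < m)
    {x : E} (hfd : DifferentiableAt ℝ f x) (hgd : DifferentiableAt ℝ g x) (hx : f x + g x = 0)
    (hR : ‖x - q‖ ≤ R) : fderiv ℝ (fun x => f x + g x) x ≠ 0 := by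
  intro h0
  rw [fderiv_fun_add hfd hgd] at h0
  have h1 := hf.add_fderiv_le hfd (q - x)
  have h2 : ‖fderiv ℝ g x‖ ≤ ε :=
    hgd.hasFDerivAt.le_of_lip' hε (Eventually.of_forall fun y => hg y x)
  have h3 := (abs_le.1 (((fderiv ℝ g x).le_opNorm (q - x)).trans
    (mul_le_mul_of_nonneg_right h2 (norm_nonneg _)))).2
  have h4 : fderiv ℝ f x (q - x) + fderiv ℝ g x (q - x) = 0 := by
    rw [← add_apply, h0, zero_apply]
  rw [add_sub_cancel] at h1
  have h5 := (abs_le.1 (hg x q)).2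
  rw [norm_sub_rev] at h3
  nlinarith [mul_le_mul_of_nonneg_left hR hε]

end Perturbation

/-! ### The domain in `ℂ³` -/

/-- The projection of `ℂ³` to the first two coordinates. -/
noncomputable def projTwo : Cn 3 →L[ℂ] Cn 2 := LinearMap.toContinuousLinearMap
  { toFun := fun x => !₂[x 0, x 1]
    map_add' := fun x y => by ext i; fin_cases i <;> simp
    map_smul' := fun k x => by ext i; fin_cases i <;> simp }

theorem projTwo_apply (x : Cn 3) : projTwo x = !₂[x 0, x 1] := rfl

theorem norm_sq_eq_projTwo (x : Cn 3) : ‖x‖ ^ 2 = ‖projTwo x‖ ^ 2 + ‖x 2‖ ^ 2 := by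
  simp [EuclideanSpace.norm_sq_eq, Fin.sum_univ_three, Fin.sum_univ_two, projTwo_apply]

theorem norm_projTwo_le (x : Cn 3) : ‖projTwo x‖ ≤ ‖x‖ := by
  refine le_of_sq_le_sq ?_ (norm_nonneg _)
  rw [norm_sq_eq_projTwo x]
  linarith [sq_nonneg ‖x 2‖]

/-- The convex function `Re w + λ(|x|² - 1)` on `ℂ³`, where `λ` is the smooth ramp. -/
noncomputable def convexModel (x : Cn 3) : ℝ := (x 2).re + smoothRamp (‖x‖ ^ 2 - 1)

theorem contDiff_re_coord : ContDiff ℝ ∞ fun x : Cn 3 => (x 2).re := by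
  have : ContDiff ℂ ∞ fun x : Cn 3 => x 2 := by fun_prop
  exact Complex.reCLM.contDiff.comp (this.restrict_scalars ℝ)

theorem contDiff_convexModel : ContDiff ℝ ∞ convexModel :=
  contDiff_re_coord.add (smoothRamp.contDiff.comp ((contDiff_norm_sq ℝ).sub contDiff_const))

theorem convexOn_convexModel : ConvexOn ℝ univ convexModel := by
  have h1 : ConvexOn ℝ univ fun x : Cn 3 => (x 2).re := by
    refine ⟨convex_univ, fun x _ y _ a b _ _ _ => le_of_eq ?_⟩
    simp
  have h2 : ConvexOn ℝ univ fun x : Cn 3 => ‖x‖ ^ 2 - 1 := by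
    have h3 : ConvexOn ℝ univ fun x : Cn 3 => ‖x‖ := convexOn_univ_norm
    exact (h3.pow (fun x _ => norm_nonneg x) 2).add (convexOn_const (-1) convex_univ)
  refine h1.add (ConvexOn.comp ?_ h2 (smoothRamp.monotone.monotoneOn _))
  exact smoothRamp.convexOn.subset (subset_univ _)
    (by
      rw [image_univ]
      have : IsPreconnected (range fun x : Cn 3 => ‖x‖ ^ 2 - 1) :=
        isPreconnected_range (by fun_prop)
      exact this.ordConnected.convex)

theorem convexModel_of_norm_le_one {x : Cn 3} (hx : ‖x‖ ≤ 1) : convexModel x = (x 2).re := by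
  rw [convexModel, smoothRamp.of_nonpos, add_zero]
  nlinarith [norm_nonneg x]

/-- Here the model is at least `‖x‖² - ‖x‖ - 2`. Its linear lower bound beats the Lipschitz
perturbation and confines the domain to radius `3`. -/
theorem convexModel_gt {x : Cn 3} (hx : 3 < ‖x‖) : 4 / 3 * ‖x‖ < convexModel x := by
  have h1 : 1 ≤ ‖x‖ ^ 2 - 1 := by nlinarith
  have h2 : -‖x‖ ≤ (x 2).re :=
    (abs_le.1 ((Complex.abs_re_le_norm _).trans (PiLp.norm_apply_le x 2))).1
  rw [convexModel, smoothRamp.of_one_le h1]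
  have := smoothRamp.nonneg 1
  nlinarith

section Domain

variable {ρ : Cn 2 → ℝ}

/-- The defining function `Re w + ρ(s, t) + λ(|x|² - 1)`. -/
noncomputable def definingFunction (ρ : Cn 2 → ℝ) (x : Cn 3) : ℝ :=
  convexModel x + ρ (projTwo x)

theorem contDiff_comp_projTwo (hρ : ContDiff ℝ ∞ ρ) : ContDiff ℝ ∞ fun x => ρ (projTwo x) :=
  hρ.comp (projTwo.contDiff.restrict_scalars ℝ)

theorem contDiff_definingFunction (hρ : ContDiff ℝ ∞ ρ) : ContDiff ℝ ∞ (definingFunction ρ) :=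
  contDiff_convexModel.add (contDiff_comp_projTwo hρ)

theorem definingFunction_of_norm_le_one {x : Cn 3} (hx : ‖x‖ ≤ 1) :
    definingFunction ρ x = (x 2).re + ρ !₂[x 0, x 1] := by
  rw [definingFunction, convexModel_of_norm_le_one hx, projTwo_apply]

theorem abs_comp_projTwo_sub_le (hlip : ∀ x y, |ρ x - ρ y| ≤ 1 / 40 * ‖x - y‖) (x y : Cn 3) :
    |ρ (projTwo x) - ρ (projTwo y)| ≤ 1 / 40 * ‖x - y‖ := by
  refine (hlip _ _).trans ?_
  rw [← map_sub]
  gcongr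
  exact norm_projTwo_le _

theorem norm_le_of_definingFunction_nonpos (h0 : ρ 0 = 0)
    (hlip : ∀ x y, |ρ x - ρ y| ≤ 1 / 40 * ‖x - y‖) {x : Cn 3} (hx : definingFunction ρ x ≤ 0) :
    ‖x‖ ≤ 3 := by
  by_contra! h
  have h1 := convexModel_gt h
  have h2 := (abs_le.1 (abs_comp_projTwo_sub_le hlip x 0)).1
  rw [map_zero, h0, sub_zero, sub_zero] at h2
  unfold definingFunction at hx
  linarith

theorem isSmoothlyBoundedDomain_definingFunction (hρ : ContDiff ℝ ∞ ρ) (h0 : ρ 0 = 0)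
    (hlip : ∀ x y, |ρ x - ρ y| ≤ 1 / 40 * ‖x - y‖) :
    IsSmoothlyBoundedDomain {x | definingFunction ρ x < 0} (definingFunction ρ) := by
  -- The model has value `-1/2` at this centre and `ρ` contributes nothing. With `R = 4` the
  -- smallness condition reads `2 · (1/40) · 4 < 1/2`.
  let q : Cn 3 := EuclideanSpace.single 2 (-(1 / 2))
  have hqn : ‖q‖ = 1 / 2 := by simp [q]
  have hgq : ρ (projTwo q) = 0 := by
    have : projTwo q = 0 := by
      rw [projTwo_apply]
      ext i
      fin_cases i <;> simp [q]
    rw [this, h0]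
  have hfq : convexModel q = -(1 / 2) := by
    rw [convexModel_of_norm_le_one (by rw [hqn]; norm_num)]
    norm_num [q]
  have hR : ∀ x : Cn 3, definingFunction ρ x ≤ 0 → ‖x - q‖ ≤ 4 := fun x hx => by
    have := norm_le_of_definingFunction_nonpos h0 hlip hx
    have := norm_sub_le x q
    linarith
  have hq : q ∈ {x | definingFunction ρ x < 0} := by
    show convexModel q + ρ (projTwo q) < 0
    rw [hgq, hfq]; norm_num
  refine ⟨?_, ?_, contDiff_definingFunction hρ, rfl, ?_⟩
  · exact ((starConvex_sublevel_of_convexOn_add convexOn_convexModel (abs_comp_projTwo_sub_le hlip)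
      (by norm_num) hgq hfq (R := 4) (fun x hx => hR x (le_of_lt hx))
      (by norm_num)).isPathConnected hq).isConnected
  · exact (isBounded_closedBall (x := (0 : Cn 3)) (r := 3)).subset fun x hx => by
      simpa using norm_le_of_definingFunction_nonpos h0 hlip (le_of_lt hx)
  · intro x hx h
    refine fderiv_ne_zero_of_convexOn_add convexOn_convexModel (by norm_num)
      (abs_comp_projTwo_sub_le hlip) hgq hfq (R := 4) (by norm_num)
      (contDiff_convexModel.differentiable (by simp) x)
      ((contDiff_comp_projTwo hρ).differentiable (by simp) x) hx (hR x hx.le) ?_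
    exact (InnerProductSpace.toDual ℝ (Cn 3)).symm.map_eq_zero_iff.1 h

/-- The Levi form is nonnegative in every direction, not only tangential ones: the model is convex,
and the closed domain projects into the ball of radius `4` where `ρ` is plurisubharmonic. -/
theorem isLeviPseudoconvex_definingFunction (hρ : ContDiff ℝ ∞ ρ) (h0 : ρ 0 = 0)
    (hlip : ∀ x y, |ρ x - ρ y| ≤ 1 / 40 * ‖x - y‖)
    (hpsh : ∀ p ∈ ball (0 : Cn 2) 4, ∀ v, 0 ≤ leviForm ρ p v) :
    IsLeviPseudoconvex {x | definingFunction ρ x < 0} (definingFunction ρ) := by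
  intro p hp v _ _
  have hp3 : ‖p‖ ≤ 3 := by
    refine norm_le_of_definingFunction_nonpos h0 hlip ?_
    exact closure_lt_subset_le (contDiff_definingFunction hρ).continuous continuous_const
      (frontier_subset_closure hp)
  have hc := (contDiff_infty.1 contDiff_convexModel 2).contDiffAt (x := p)
  rw [show definingFunction ρ = fun x => convexModel x + ρ (projTwo x) from rfl,
    leviForm_add hc (contDiff_infty.1 (contDiff_comp_projTwo hρ) 2).contDiffAt,
    leviForm_comp_clm projTwo (contDiff_infty.1 hρ 2).contDiffAt]
  refine add_nonneg (convexOn_convexModel.leviForm_nonneg hc v) (hpsh _ ?_ _)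
  rw [mem_ball_zero_iff]
  linarith [norm_projTwo_le p]

theorem hasFDerivAt_zero_of_flat (hflat : ∀ k : ℕ, ∃ s > 0, ∀ z : Cn 2, ‖z‖ < s → |ρ z| ≤ 2 * ‖z‖ ^ k) :
    HasFDerivAt ρ (0 : Cn 2 →L[ℝ] ℝ) 0 := by
  refine IsBigO.hasFDerivAt (n := 2) (IsBigO.of_bound 2 ?_) one_lt_two
  obtain ⟨s, hs, h⟩ := hflat 2
  filter_upwards [ball_mem_nhds (0 : Cn 2) hs] with z hz
  simpa using h z (by simpa using hz)

theorem gradient_definingFunction_zero (hd : HasFDerivAt ρ (0 : Cn 2 →L[ℝ] ℝ) 0) :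
    ∇ (definingFunction ρ) 0 = EuclideanSpace.single 2 1 := by
  apply HasGradientAt.gradient
  rw [hasGradientAt_iff_hasFDerivAt]
  have h1 : HasFDerivAt (fun x : Cn 3 => (x 2).re)
      (Complex.reCLM ∘L (EuclideanSpace.proj (2 : Fin 3) : Cn 3 →L[ℂ] ℂ).restrictScalars ℝ) 0 :=
    ContinuousLinearMap.hasFDerivAt
      (Complex.reCLM ∘L (EuclideanSpace.proj (2 : Fin 3) : Cn 3 →L[ℂ] ℂ).restrictScalars ℝ)
  have h2 : HasFDerivAt (fun x : Cn 3 => ρ (projTwo x))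
      ((0 : Cn 2 →L[ℝ] ℝ) ∘L projTwo.restrictScalars ℝ) 0 :=
    HasFDerivAt.comp (0 : Cn 3) (by simpa using hd) (projTwo.restrictScalars ℝ).hasFDerivAt
  have h3 := (h1.add h2).congr_of_eventuallyEq (f₁ := definingFunction ρ) (by
    filter_upwards [ball_mem_nhds (0 : Cn 3) one_pos] with x hx
    rw [definingFunction_of_norm_le_one (mem_ball_zero_iff.1 hx).le]
    rfl)
  refine h3.congr_fderiv ?_
  ext v
  simp [PiLp.inner_apply, Fin.sum_univ_three]

theorem unitOutwardNormal_definingFunction_zero (hd : HasFDerivAt ρ (0 : Cn 2 →L[ℝ] ℝ) 0) :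
    unitOutwardNormal (definingFunction ρ) 0 = EuclideanSpace.single 2 1 := by
  rw [unitOutwardNormal, gradient_definingFunction_zero hd]
  simp

/-- The complex line in the `s`-direction has order one, while `Re w = 0` on it and `ρ` is flat, so
the defining function vanishes along it to infinite order. -/
theorem dAngeloType_definingFunction_zero
    (hflat : ∀ k : ℕ, ∃ s > 0, ∀ z : Cn 2, ‖z‖ < s → |ρ z| ≤ 2 * ‖z‖ ^ k) :
    dAngeloType (definingFunction ρ) 0 = ⊤ := by
  let e : Cn 3 := EuclideanSpace.single 0 1
  let γ : ℂ → Cn 3 := fun ζ => ζ • e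
  have hn : ∀ ζ, ‖γ ζ‖ = ‖ζ‖ := fun ζ => by simp [γ, e, norm_smul]
  have hγ : HasFDerivAt γ ((1 : ℂ →L[ℂ] ℂ).smulRight e) 0 :=
    ((1 : ℂ →L[ℂ] ℂ).smulRight e).hasFDerivAt
  have hd : Differentiable ℂ γ := by fun_prop
  have htop : vanishingOrder (fun ζ => definingFunction ρ (γ ζ)) = ⊤ := by
    refine ENat.eq_top_iff_forall_ge.2 fun k => ?_
    refine le_iSup₂_of_le k ?_ le_rfl
    refine IsBigO.of_bound 2 ?_
    obtain ⟨s, hs, h⟩ := hflat k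
    filter_upwards [ball_mem_nhds (0 : ℂ) (lt_min hs one_pos)] with ζ hζ
    rw [mem_ball_zero_iff, lt_min_iff] at hζ
    have hz : ‖(!₂[ζ, 0] : Cn 2)‖ = ‖ζ‖ := by
      simp [EuclideanSpace.norm_eq]
    rw [definingFunction_of_norm_le_one (by rw [hn]; exact hζ.2.le)]
    have := h !₂[ζ, 0] (by rw [hz]; exact hζ.1)
    rw [hz] at this
    simpa [γ, e] using this
  have hone : vanishingOrder (fun ζ => γ ζ - 0) ≤ 1 := by
    refine iSup₂_le fun k hk => ?_
    by_contra! hlt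
    have h1 : 1 < k := by exact_mod_cast hlt
    have h2 : γ =O[𝓝 0] fun ζ : ℂ => ‖ζ - 0‖ ^ k := by simpa using hk
    have h3 := congrArg (fun T : ℂ →L[ℂ] Cn 3 => T 1) (hγ.unique (h2.hasFDerivAt (𝕜 := ℂ) h1))
    simp [e] at h3
  refine eq_top_iff.2 (le_iSup₂_of_le γ ⟨hd.analyticAt 0, by simp [γ], fun h => ?_⟩ ?_)
  · have h3 : γ =ᶠ[𝓝 0] fun _ => 0 := h
    have h4 := congrArg (fun T : ℂ →L[ℂ] Cn 3 => T 1)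
      (hγ.unique ((hasFDerivAt_const (0 : Cn 3) (0 : ℂ)).congr_of_eventuallyEq h3))
    simp [e] at h4
  · rw [htop, ENat.toENNReal_top, ENNReal.top_div_of_ne_top]
    refine ne_top_of_le_ne_top ENNReal.one_ne_top ?_
    exact_mod_cast hone

/-! ### Kobayashi bound and conclusion -/

/-- The explicit discs through the inner normal at the origin. -/
theorem kobayashiMetric_definingFunction_le {c δ a : ℝ} (ha : 0 < a) (hδ : 0 < δ)
    (hδ1 : δ ≤ 1 / 4) (haδ : a * δ ≤ 1 / 4)
    (h : ∀ ζ : ℂ, ‖ζ‖ < 1 →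
      ‖(!₂[(c : ℂ) ^ 2 * ζ ^ 2, (c : ℂ) ^ 3 * ζ ^ 3] : Cn 2)‖ < 1 / 2 ∧
      ρ !₂[(c : ℂ) ^ 2 * ζ ^ 2, (c : ℂ) ^ 3 * ζ ^ 3] < δ * (1 - a * ζ.re)) :
    0 - δ • EuclideanSpace.single 2 1 ∈ {x | definingFunction ρ x < 0} ∧
    kobayashiMetric {x | definingFunction ρ x < 0} (0 - δ • EuclideanSpace.single 2 1)
      (EuclideanSpace.single 2 1) ≤ 1 / (a * δ) := by
  let φ : ℂ → Cn 3 := fun ζ => ((c : ℂ) ^ 2 * ζ ^ 2) • EuclideanSpace.single 0 1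
    + ((c : ℂ) ^ 3 * ζ ^ 3) • EuclideanSpace.single 1 1
    + (-δ + ((a * δ : ℝ) : ℂ) * ζ) • EuclideanSpace.single 2 1
  have h0 : ∀ ζ, φ ζ 0 = (c : ℂ) ^ 2 * ζ ^ 2 := fun ζ => by simp [φ]
  have h1 : ∀ ζ, φ ζ 1 = (c : ℂ) ^ 3 * ζ ^ 3 := fun ζ => by simp [φ]
  have h2 : ∀ ζ, φ ζ 2 = -δ + ((a * δ : ℝ) : ℂ) * ζ := fun ζ => by simp [φ]
  have hφ0 : φ 0 = 0 - δ • EuclideanSpace.single 2 1 := by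
    ext i
    fin_cases i <;> simp [φ]
  have hmaps : MapsTo φ (ball 0 1) {x | definingFunction ρ x < 0} := by
    intro ζ hζ
    rw [mem_ball_zero_iff] at hζ
    obtain ⟨h3, h4⟩ := h ζ hζ
    have h5 : ‖φ ζ 2‖ ≤ 1 / 2 := by
      rw [h2]
      refine (norm_add_le _ _).trans ?_
      rw [norm_neg, norm_mul, Complex.norm_real, Complex.norm_real, Real.norm_of_nonneg hδ.le,
        Real.norm_of_nonneg (by positivity)]
      have : a * δ * ‖ζ‖ ≤ a * δ := mul_le_of_le_one_right (by positivity) hζ.le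
      linarith
    -- The disc stays in the unit ball, where the ramp vanishes and the defining function is exactly
    -- `Re w + ρ`.
    have h6 : ‖φ ζ‖ ≤ 1 := by
      refine le_of_sq_le_sq ?_ zero_le_one
      rw [norm_sq_eq_projTwo, projTwo_apply, h0, h1]
      nlinarith [norm_nonneg (φ ζ 2),
        norm_nonneg (!₂[(c : ℂ) ^ 2 * ζ ^ 2, (c : ℂ) ^ 3 * ζ ^ 3] : Cn 2)]
    show definingFunction ρ (φ ζ) < 0
    rw [definingFunction_of_norm_le_one h6, h0, h1, h2]
    simp only [Complex.add_re, Complex.neg_re, Complex.ofReal_re, Complex.re_ofReal_mul]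
    linarith
  have hd : Differentiable ℂ φ := by fun_prop
  refine ⟨hφ0 ▸ hmaps (mem_ball_self one_pos), ?_⟩
  refine csInf_le ⟨0, fun α hα => hα.1.le⟩ ⟨by positivity, φ, hd.differentiableOn, hmaps, hφ0, ?_⟩
  -- The singularity of the cusp at `ζ = 0` is what makes the initial velocity purely normal.
  have hp : ∀ k : ℕ, HasDerivAt (fun ζ : ℂ => ζ ^ (k + 2)) 0 0 := fun k => by
    simpa using hasDerivAt_pow (k + 2) (0 : ℂ)
  have h3 : HasDerivAt φ _ 0 :=
    ((((hp 0).const_mul ((c : ℂ) ^ 2)).smul_const (EuclideanSpace.single (0 : Fin 3) (1 : ℂ))).add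
      (((hp 1).const_mul ((c : ℂ) ^ 3)).smul_const
        (EuclideanSpace.single (1 : Fin 3) (1 : ℂ)))).add
      ((((hasDerivAt_id (0 : ℂ)).const_mul ((a * δ : ℝ) : ℂ)).const_add (-(δ : ℂ))).smul_const
        (EuclideanSpace.single (2 : Fin 3) (1 : ℂ)))
  rw [h3.deriv]
  ext i
  fin_cases i <;> simp

end Domain
theorem mainTheorem1 (a : ℕ → ℝ) (ha_pos : ∀ n, 0 < a n) (ha_mono : Monotone a)
    (ha_top : Tendsto a atTop atTop) :
    ∃ (Ω : Set (Cn 3)) (r : Cn 3 → ℝ) (P : Cn 3) (δ : ℕ → ℝ),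
      -- a smoothly bounded pseudoconvex domain, of infinite type at the boundary point `P`
      IsSmoothlyBoundedDomain Ω r ∧
      IsLeviPseudoconvex Ω r ∧
      P ∈ frontier Ω ∧
      dAngeloType r P = ⊤ ∧
      -- near `P = 0` it is `{Re w + ρ(s, t) < 0}` with `ρ` smooth and plurisubharmonic
      P = 0 ∧
      (∃ (ρ : Cn 2 → ℝ) (ε : ℝ), 0 < ε ∧
        ContDiffOn ℝ ∞ ρ (ball 0 ε) ∧
        (∀ z ∈ ball (0 : Cn 2) ε, ∀ v, 0 ≤ leviForm ρ z v) ∧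
        ρ 0 = 0 ∧ fderiv ℝ ρ 0 = 0 ∧
        ∀ x ∈ ball (0 : Cn 3) ε, r x = (x 2).re + ρ !₂[x 0, x 1]) ∧
      -- the upper bound for the Kobayashi metric in the normal direction
      (∀ n, 0 < δ n) ∧ StrictAnti δ ∧ Tendsto δ atTop (𝓝 0) ∧
      (∀ n, P - δ n • unitOutwardNormal r P ∈ Ω ∧
        kobayashiMetric Ω (P - δ n • unitOutwardNormal r P) (unitOutwardNormal r P)
          ≤ 1 / (a n * δ n)) ∧
      -- no lower bound by a constant over the distance
      ¬ ∃ C > 0, ∀ᶠ d in 𝓝[>] (0 : ℝ),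
        C / d ≤ kobayashiMetric Ω (P - d • unitOutwardNormal r P) (unitOutwardNormal r P) := by
  obtain ⟨ρ, δ, c, hρ, hpsh, hlip, hflat, hδ0, hδanti, hδlim, hδ1, haδ, hdisc⟩ :=
    exists_flat_psh_on_cusps ha_pos (ε := 1 / 40) (by norm_num)
  have hρ0 : ρ 0 = 0 := by
    obtain ⟨s, hs, h⟩ := hflat 1
    simpa using h 0 (by simpa using hs)
  have hd := hasFDerivAt_zero_of_flat hflat
  have hν := unitOutwardNormal_definingFunction_zero hd
  have hK := fun n => kobayashiMetric_definingFunction_le (ha_pos n) (hδ0 n) (hδ1 n) (haδ n)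
    (hdisc n)
  refine ⟨{x | definingFunction ρ x < 0}, definingFunction ρ, 0, δ,
    isSmoothlyBoundedDomain_definingFunction hρ hρ0 hlip,
    isLeviPseudoconvex_definingFunction hρ hρ0 hlip hpsh, ?_,
    dAngeloType_definingFunction_zero hflat, rfl,
    ⟨ρ, 1, one_pos, hρ.contDiffOn, fun z hz v => hpsh z (ball_subset_ball (by norm_num) hz) v, hρ0,
      hd.fderiv, fun x hx => definingFunction_of_norm_le_one (mem_ball_zero_iff.1 hx).le⟩,
    hδ0, hδanti, hδlim, fun n => by rw [hν]; exact hK n, ?_⟩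
  · refine ⟨mem_closure_of_tendsto (f := fun n => 0 - δ n • EuclideanSpace.single 2 1)
      (b := atTop) ?_ (Eventually.of_forall fun n => (hK n).1), fun h => ?_⟩
    · simpa using (hδlim.smul_const (EuclideanSpace.single (2 : Fin 3) (1 : ℂ))).const_sub 0
    · have h1 : definingFunction ρ 0 < 0 :=
        interior_subset (s := {x | definingFunction ρ x < 0}) h
      rw [definingFunction_of_norm_le_one (by simp)] at h1
      have h2 : (!₂[0, 0] : Cn 2) = 0 := by ext i; fin_cases i <;> rfl
      simp [h2, hρ0] at h1
  · rintro ⟨C, hC, hev⟩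
    have hlim : Tendsto δ atTop (𝓝[>] 0) :=
      tendsto_nhdsWithin_iff.2 ⟨hδlim, Eventually.of_forall hδ0⟩
    -- Any `n` with `aₙ > 1/C` at which the supposed lower bound holds contradicts the upper bound
    -- `1/(aₙδₙ)`.
    obtain ⟨n, h1, h2⟩ := ((hlim.eventually hev).and
      (ha_top.eventually_gt_atTop (1 / C))).exists
    rw [hν] at h1
    have h3 := h1.trans (hK n).2
    have h4 := hδ0 n
    have h5 := ha_pos n
    rw [div_le_div_iff₀ h4 (by positivity)] at h3
    rw [div_lt_iff₀ hC] at h2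
    nlinarith
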